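/- For $s,d\in\mathbb N=\{1,2,\dots\}$ and a function $f$ on $[0,1]^d$ put $\|f\|_{s,\mathrm{mix}}^2=\sum_{\alpha\in\mathbb N_0^d,\ \|\alpha\|_\infty\le s}\|D^\alpha f\|_{L_2}^2$. Let $H_d^{s,\mathrm{mix}}$ be the closure in $C([0,1]^d)$, with respect to $\|\cdot\|_{s,\mathrm{mix}}$, of $\{f\in C^{sd}([0,1]^d):\|f\|_{s,\mathrm{mix}}\le 1\}$ (derivatives of the limits being weak derivatives), and let $\mathring H_d^{s,\mathrm{mix}}$ be the set of all $f\in H_d^{s,\mathrm{mix}}$ whose closed support is contained in $(0,1)^d$. For a functional $Q$ on functions and a class $H$ let $e(Q,H)=\sup_{f\in H}\bigl|\int_{[0,1]^d}f(x)\,dx-Q(f)\bigr|$. Let $P_d(t)=\prod_{j=1}^d(t-2j+1)-1$. For an enumeration $\xi=(\xi_1,\dots,\xi_d)$ of $d$ different real roots of $P_d$ let $B=(\xi_i^{j-1})_{i,j=1}^d$, $T=(B^\top)^{-1}$, and for $a>1$ let $$X_a^d=\bigl(a^{-1}T(\mathbb Z^d)\bigr)\cap[0,1)^d,\qquad \mathring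 Q_a(f)=a^{-d}\,|\det T|\sum_{x\in X_a^d}f(x).$$ Theorem 1. Let $s,d\in\mathbb N$. Then $P_d$ has $d$ different real roots, and there is a constant $C_{s,d}$, depending only on $s$ and $d$, such that for every enumeration $\xi_1,\dots,\xi_d$ of these roots the following hold. (i) For every $a>1$ the set $X_a^d$ is finite and, with $n=|X_a^d|$, $$e(\mathring Q_a,\mathring H_d^{s,\mathrm{mix}})\le C_{s,d}\,n^{-s}(\log n)^{\frac{d-1}{2}}.$$ (ii) There is a sequence $(Q_n)_{n\in\mathbb N}$ of cubature rules $Q_n(f)=\sum_{j=1}^n a_jf(x^j)$ with $a_j\in\mathbb R$ and $x^j\in[0,1]^d$ (so that $Q_n$ uses at most $n$ nodes) such that $$e(Q_n,\mathring H_d^{s,\mathrm{mix}})\le C_{s,d}\,n^{-s}(\log n)^{\frac{d-1}{2}}\qquad\text{for all } n\ge 2,$$ and such that for all sufficiently large $n$ the rule $Q_n$ equals $\mathring Q_a$ for some $a>1$ with $|X_a^d|\le n$. -/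

import Mathlib

open MeasureTheory Filter Topology
open scoped ENNReal

noncomputable section

namespace Frolov

/-- The closed unit cube `[0,1]^d`. -/
def cube (d : ℕ) : Set (Fin d → ℝ) := Set.Icc 0 1

/-- The open unit cube `(0,1)^d`. -/
def openCube (d : ℕ) : Set (Fin d → ℝ) := Set.univ.pi fun _ => Set.Ioo (0 : ℝ) 1

/-- The half-open unit cube `[0,1)^d`. -/
def halfOpenCube (d : ℕ) : Set (Fin d → ℝ) := Set.univ.pi fun _ => Set.Ico (0 : ℝ) 1

/-- The classical first partial derivative `∂_i f`. -/
def partialDeriv {d : ℕ} (i : Fin d) (f : (Fin d → ℝ) → ℝ) : (Fin d → ℝ) → ℝ :=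
  fun x => fderiv ℝ f x (Pi.single i 1)

/-- The classical partial derivative `D^α f = ∂_1^{α_1} ⋯ ∂_d^{α_d} f`. -/
def mixedPartial {d : ℕ} (α : Fin d → ℕ) (f : (Fin d → ℝ) → ℝ) : (Fin d → ℝ) → ℝ :=
  (List.finRange d).foldr (fun i g => (partialDeriv i)^[α i] g) f

/-- The multi-indices `α ∈ ℕ₀^d` with `‖α‖_∞ ≤ s`. -/
def multiIndices (d s : ℕ) : Finset (Fin d → ℕ) :=
  Fintype.piFinset fun _ => Finset.range (s + 1)

/-- `g` is the weak derivative of order `α` of `f` on the open unit cube. -/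
def IsWeakDeriv {d : ℕ} (α : Fin d → ℕ) (f g : (Fin d → ℝ) → ℝ) : Prop :=
  LocallyIntegrableOn f (openCube d) ∧ LocallyIntegrableOn g (openCube d) ∧
    ∀ φ : (Fin d → ℝ) → ℝ, ContDiff ℝ (⊤ : ℕ∞) φ → HasCompactSupport φ →
      tsupport φ ⊆ openCube d →
      ∫ x in openCube d, f x * mixedPartial α φ x
        = (-1) ^ (∑ i, α i) * ∫ x in openCube d, g x * φ x

/-- The mixed Sobolev norm `(∑_{‖α‖_∞ ≤ s} ‖D^α f‖_{L_2}^2)^{1/2}` of a function `f` on the unit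
cube, written in terms of the family `F α = D^α f` of its derivatives. -/
def mixNorm {d : ℕ} (s : ℕ) (F : (Fin d → ℕ) → (Fin d → ℝ) → ℝ) : ℝ≥0∞ :=
  (∑ α ∈ multiIndices d s, eLpNorm (F α) 2 (volume.restrict (openCube d)) ^ 2) ^ (1 / 2 : ℝ)

/-- The functions `g ∈ C^{sd}([0,1]^d)` with `‖g‖_{s,mix} ≤ 1`. -/
def smoothBall (s d : ℕ) : Set ((Fin d → ℝ) → ℝ) :=
  {g | ContDiffOn ℝ ((s * d : ℕ) : WithTop ℕ∞) g (cube d) ∧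
    mixNorm s (fun α => mixedPartial α g) ≤ 1}

/-- The class `H_d^{s,mix}`: the closure of `smoothBall s d` in `C([0,1]^d)` with respect to
`‖·‖_{s,mix}`. The family `F` consists of the (weak) derivatives of `f`.
Only the values of `f` on `[0,1]^d` matter. -/
def mixClass (s d : ℕ) : Set ((Fin d → ℝ) → ℝ) :=
  {f | ContinuousOn f (cube d) ∧
    ∃ F : (Fin d → ℕ) → (Fin d → ℝ) → ℝ,
      (∀ α ∈ multiIndices d s,
        MemLp (F α) 2 (volume.restrict (openCube d)) ∧ IsWeakDeriv α f (F α)) ∧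
      ∀ ε : ℝ≥0∞, 0 < ε → ∃ g ∈ smoothBall s d,
        mixNorm s (fun α x => F α x - mixedPartial α g x) < ε}

/-- The subclass of all `f ∈ H_d^{s,mix}` whose (closed) support is contained in `(0,1)^d`. -/
def mixClassZero (s d : ℕ) : Set ((Fin d → ℝ) → ℝ) :=
  {f | f ∈ mixClass s d ∧ closure {x | x ∈ cube d ∧ f x ≠ 0} ⊆ openCube d}

/-- A cubature rule `Q_n(f) = ∑_{j=1}^n a_j f(x^j)` with nodes in `[0,1]^d` and real weights.
Nodes may coincide and weights may vanish, so these are the rules with at most `n` nodes. -/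
structure CubatureRule (d n : ℕ) where
  node : Fin n → Fin d → ℝ
  node_mem : ∀ j, node j ∈ cube d
  weight : Fin n → ℝ

/-- The value of a cubature rule at a function. -/
def CubatureRule.eval {d n : ℕ} (Q : CubatureRule d n) (f : (Fin d → ℝ) → ℝ) : ℝ :=
  ∑ j, Q.weight j * f (Q.node j)

/-- The worst-case error `sup_{f ∈ H} |I(f) - Q(f)|`, `I(f) = ∫_{[0,1]^d} f`. -/
def worstCaseError {d : ℕ} (Q : ((Fin d → ℝ) → ℝ) → ℝ) (H : Set ((Fin d → ℝ) → ℝ)) : ℝ≥0∞ :=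
  ⨆ f ∈ H, ENNReal.ofReal |(∫ x in cube d, f x) - Q f|

/-- The polynomial `P_d(t) = ∏_{j=1}^d (t - 2j + 1) - 1`. -/
def frolovPoly (d : ℕ) : Polynomial ℝ :=
  ∏ j ∈ Finset.Icc 1 d, (Polynomial.X - Polynomial.C (2 * (j : ℝ) - 1)) - 1

/-- `ξ_1, …, ξ_d` are `d` different real roots of `P_d` (hence all of its roots). -/
def IsRootEnumeration (d : ℕ) (ξ : Fin d → ℝ) : Prop :=
  Function.Injective ξ ∧ ∀ i, (frolovPoly d).IsRoot (ξ i)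

/-- The generator `T = (Bᵀ)⁻¹`, where `B = (ξ_i^{j-1})_{i,j}` is the Vandermonde matrix. -/
def generator {d : ℕ} (ξ : Fin d → ℝ) : Matrix (Fin d) (Fin d) ℝ :=
  ((Matrix.vandermonde ξ).transpose)⁻¹

/-- The node set `X_a^d = (a⁻¹ T(ℤ^d)) ∩ [0,1)^d`. -/
def frolovNodes {d : ℕ} (ξ : Fin d → ℝ) (a : ℝ) : Set (Fin d → ℝ) :=
  {x | ∃ z : Fin d → ℤ, x = a⁻¹ • (generator ξ).mulVec (fun i => (z i : ℝ))} ∩ halfOpenCube d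

/-- The rule `a^{-d} |det T| ∑_{x ∈ X_a^d} f(x)`. -/
def frolovRule {d : ℕ} (ξ : Fin d → ℝ) (a : ℝ) (f : (Fin d → ℝ) → ℝ) : ℝ :=
  (a ^ d)⁻¹ * |(generator ξ).det| * ∑ᶠ x ∈ frolovNodes ξ a, f x

/-- The rate `n^{-s} (log n)^{(d-1)/2}`. -/
def rate (s d n : ℕ) : ℝ :=
  ((n : ℝ) ^ s)⁻¹ * Real.log n ^ (((d : ℝ) - 1) / 2)

end Frolov

end

noncomputable section

namespace Frolov

/-- The polynomial `∏_{j=1}^d (t - 2j + 1) - 1` with integer coefficients. -/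
def intFrolovPoly (d : ℕ) : Polynomial ℤ :=
  ∏ j ∈ Finset.Icc 1 d, (Polynomial.X - Polynomial.C (2 * (j : ℤ) - 1)) - 1

lemma map_intFrolovPoly (d : ℕ) :
    (intFrolovPoly d).map (Int.castRingHom ℝ) = frolovPoly d := by
  simp only [intFrolovPoly, frolovPoly, Polynomial.map_sub, Polynomial.map_prod,
    Polynomial.map_X, Polynomial.map_C, Polynomial.map_one]
  simp

lemma natDegree_prod_odd (d : ℕ) :
    (∏ j ∈ Finset.Icc 1 d, (Polynomial.X - Polynomial.C (2 * (j : ℤ) - 1))).natDegree = d := by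
  rw [Polynomial.natDegree_finsetProd_X_sub_C_eq_card]
  simp

lemma natDegree_intFrolovPoly (d : ℕ) : (intFrolovPoly d).natDegree = d := by
  rw [intFrolovPoly, ← Polynomial.C_1, Polynomial.natDegree_sub_C, natDegree_prod_odd]

lemma monic_intFrolovPoly {d : ℕ} (hd : 1 ≤ d) : (intFrolovPoly d).Monic := by
  have hm : (∏ j ∈ Finset.Icc 1 d,
      (Polynomial.X - Polynomial.C (2 * (j : ℤ) - 1))).Monic :=
    Polynomial.monic_prod_of_monic _ _ fun j _ => Polynomial.monic_X_sub_C _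
  refine hm.sub_of_left ?_
  rw [Polynomial.degree_eq_natDegree hm.ne_zero, natDegree_prod_odd, Polynomial.degree_one]
  exact_mod_cast hd

lemma eval_intFrolovPoly_odd {d j : ℕ} (hj : j ∈ Finset.Icc 1 d) :
    (intFrolovPoly d).eval (2 * (j : ℤ) - 1) = -1 := by
  rw [intFrolovPoly, Polynomial.eval_sub, Polynomial.eval_prod, Finset.prod_eq_zero hj] <;> simp

lemma irreducible_intFrolovPoly {d : ℕ} (hd : 1 ≤ d) : Irreducible (intFrolovPoly d) := by
  have hP := monic_intFrolovPoly hd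
  refine (hP.irreducible_iff_natDegree).2 ⟨?_, ?_⟩
  · intro h
    have := natDegree_intFrolovPoly d
    rw [h, Polynomial.natDegree_one] at this
    omega
  intro f g hf hg hfg
  by_contra! hcon
  have hdeg : f.natDegree + g.natDegree = d := by
    rw [← hf.natDegree_mul hg, hfg, natDegree_intFrolovPoly]
  have hsum : f + g = 0 := by
    by_contra hne
    have hle : (f + g).natDegree < d := by
      refine (Polynomial.natDegree_add_le f g).trans_lt ?_
      have h1 := Nat.pos_of_ne_zero hcon.1
      have h2 := Nat.pos_of_ne_zero hcon.2
      omega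
    have hroot : ∀ x ∈ (Finset.Icc 1 d).image (fun j : ℕ => 2 * (j : ℤ) - 1),
        (f + g).eval x = 0 := by
      intro x hx
      obtain ⟨j, hj, rfl⟩ := Finset.mem_image.1 hx
      have h := eval_intFrolovPoly_odd hj
      rw [← hfg, Polynomial.eval_mul] at h
      rw [Polynomial.eval_add]
      rcases Int.eq_one_or_neg_one_of_mul_eq_neg_one h with h1 | h1
      · rw [h1] at h ⊢; linarith
      · rw [h1] at h ⊢; linarith
    refine hne (Polynomial.eq_zero_of_natDegree_lt_card_of_eval_eq_zero' _ _ hroot ?_)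
    rw [Finset.card_image_of_injective _ (fun a b hab => by simpa using hab)]
    simpa using hle
  have hfeq : f = -g := eq_neg_of_add_eq_zero_left hsum
  have h1 := hf.leadingCoeff
  rw [hfeq, Polynomial.leadingCoeff_neg, hg.leadingCoeff] at h1
  norm_num at h1

section Enumeration

variable {d : ℕ} {ξ : Fin d → ℝ}

lemma frolovPoly_monic (hd : 1 ≤ d) : (frolovPoly d).Monic := by
  rw [← map_intFrolovPoly]; exact (monic_intFrolovPoly hd).map _

lemma natDegree_frolovPoly (hd : 1 ≤ d) : (frolovPoly d).natDegree = d := by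
  rw [← map_intFrolovPoly, (monic_intFrolovPoly hd).natDegree_map, natDegree_intFrolovPoly]

lemma IsRootEnumeration.frolovPoly_eq (hd : 1 ≤ d) (h : IsRootEnumeration d ξ) :
    frolovPoly d = (Finset.univ.val.map ξ |>.map fun t => Polynomial.X - Polynomial.C t).prod := by
  have hdvd : (Finset.univ.val.map ξ |>.map fun t => Polynomial.X - Polynomial.C t).prod ∣
      frolovPoly d := by
    rw [Multiset.map_map]
    exact Finset.prod_dvd_of_coprime
      (fun i _ j _ hij => (Polynomial.pairwise_coprime_X_sub_C h.1) hij)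
      (fun i _ => Polynomial.dvd_iff_isRoot.2 (h.2 i))
  refine (Polynomial.eq_of_monic_of_dvd_of_natDegree_le
    (Polynomial.monic_multisetProd_X_sub_C _) (frolovPoly_monic hd) hdvd ?_)
  rw [natDegree_frolovPoly hd, Polynomial.natDegree_multiset_prod_X_sub_C_eq_card]
  simp

lemma IsRootEnumeration.esymm_int (hd : 1 ≤ d) (h : IsRootEnumeration d ξ) (k : ℕ) :
    ∃ z : ℤ, (Finset.univ.val.map ξ).esymm k = z := by
  have hcard : (Finset.univ.val.map ξ).card = d := by simp
  rcases le_or_gt k d with hk | hk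
  · have h1 := Multiset.prod_X_sub_C_coeff (Finset.univ.val.map ξ) (k := d - k) (by rw [hcard]; omega)
    rw [← h.frolovPoly_eq hd, ← map_intFrolovPoly, Polynomial.coeff_map, hcard,
      show d - (d - k) = k by omega] at h1
    refine ⟨(-1) ^ k * (intFrolovPoly d).coeff (d - k), ?_⟩
    push_cast
    simp only [eq_intCast] at h1
    rw [h1, ← mul_assoc, ← mul_pow]
    simp
  · refine ⟨0, ?_⟩
    rw [Multiset.esymm, Multiset.powersetCard_eq_empty _ (by rw [hcard]; exact hk)]
    simp

/-- An integral symmetric polynomial takes an integral value at the roots. -/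
lemma IsRootEnumeration.symmetric_int (hd : 1 ≤ d) (h : IsRootEnumeration d ξ)
    {p : MvPolynomial (Fin d) ℤ} (hp : p.IsSymmetric) :
    ∃ z : ℤ, MvPolynomial.aeval ξ p = z := by
  obtain ⟨q, hq⟩ := MvPolynomial.esymmAlgHom_surjective (σ := Fin d) (R := ℤ) (n := d) (by simp)
    ⟨p, hp⟩
  have hq' : MvPolynomial.aeval (fun i : Fin d => MvPolynomial.esymm (Fin d) ℤ (i + 1)) q = p := by
    rw [← MvPolynomial.esymmAlgHom_apply, hq]
  choose z hz using fun i : Fin d => h.esymm_int hd (i + 1)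
  refine ⟨MvPolynomial.aeval z q, ?_⟩
  rw [← hq', ← AlgHom.comp_apply, MvPolynomial.comp_aeval]
  have : (fun i : Fin d => MvPolynomial.aeval ξ (MvPolynomial.esymm (Fin d) ℤ (i + 1))) =
      fun i => algebraMap ℤ ℝ (z i) := by
    funext i
    rw [MvPolynomial.aeval_esymm_eq_multiset_esymm, hz]
    simp
  rw [this, ← Function.comp_def, MvPolynomial.aeval_algebraMap_apply]
  simp

/-- The power sums of the roots are integers. -/
lemma IsRootEnumeration.sum_pow_int (hd : 1 ≤ d) (h : IsRootEnumeration d ξ) (k : ℕ) :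
    ∃ z : ℤ, ∑ i, ξ i ^ k = z := by
  obtain ⟨z, hz⟩ := h.symmetric_int hd (MvPolynomial.psum_isSymmetric (Fin d) ℤ k)
  exact ⟨z, by simpa [MvPolynomial.psum] using hz⟩

lemma vandermonde_mulVec_apply (ξ : Fin d → ℝ) (z : Fin d → ℤ) (i : Fin d) :
    (Matrix.vandermonde ξ).mulVec (fun j => (z j : ℝ)) i = ∑ j : Fin d, ξ i ^ (j : ℕ) * z j := by
  simp [Matrix.mulVec, dotProduct, Matrix.vandermonde_apply]

lemma IsRootEnumeration.eval_ne_zero (hd : 1 ≤ d) (h : IsRootEnumeration d ξ)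
    {z : Fin d → ℤ} (hz : z ≠ 0) (i : Fin d) :
    (Matrix.vandermonde ξ).mulVec (fun j => (z j : ℝ)) i ≠ 0 := by
  rw [vandermonde_mulVec_apply]
  intro h0
  set q : Polynomial ℚ := ∑ j : Fin d, Polynomial.C (z j : ℚ) * Polynomial.X ^ (j : ℕ) with hq
  have hcoeff : ∀ j : Fin d, q.coeff j = z j := by
    intro j
    simp only [hq, Polynomial.finsetSum_coeff, Polynomial.coeff_C_mul, Polynomial.coeff_X_pow]
    rw [Finset.sum_eq_single j] <;> simp +contextual [Fin.val_inj, eq_comm]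
  have hq0 : q ≠ 0 := by
    intro h'
    apply hz
    funext j
    have := hcoeff j
    rw [h'] at this
    simpa using this.symm
  have hdeg : q.degree < d := by
    refine (Polynomial.degree_sum_le _ _).trans_lt ?_
    rw [Finset.sup_lt_iff (by exact_mod_cast WithBot.bot_lt_coe d)]
    intro j _
    exact (Polynomial.degree_C_mul_X_pow_le _ _).trans_lt (by exact_mod_cast j.2)
  have hroot : Polynomial.aeval (ξ i) q = 0 := by
    rw [hq, map_sum, ← h0]
    exact Finset.sum_congr rfl fun j _ => by simp [mul_comm]
  have hirr : Irreducible ((intFrolovPoly d).map (Int.castRingHom ℚ)) := by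
    have := (monic_intFrolovPoly hd).irreducible_iff_irreducible_map_fraction_map (K := ℚ)
    exact this.1 (irreducible_intFrolovPoly hd)
  have hmin : (intFrolovPoly d).map (Int.castRingHom ℚ) = minpoly ℚ (ξ i) := by
    refine minpoly.eq_of_irreducible_of_monic hirr ?_ ((monic_intFrolovPoly hd).map _)
    have h2 := h.2 i
    rw [← map_intFrolovPoly, Polynomial.IsRoot, Polynomial.eval_map] at h2
    rw [Polynomial.aeval_def, Polynomial.eval₂_map]
    rwa [RingHom.ext_int ((algebraMap ℚ ℝ).comp (Int.castRingHom ℚ)) (Int.castRingHom ℝ)]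
  have h3 := minpoly.degree_le_of_ne_zero ℚ (ξ i) hq0 hroot
  rw [← hmin, Polynomial.degree_eq_natDegree ((monic_intFrolovPoly hd).map _).ne_zero,
    (monic_intFrolovPoly hd).natDegree_map, natDegree_intFrolovPoly] at h3
  exact absurd hdeg (not_lt.2 h3)

/-- The key property of the Frolov lattice: nonzero lattice points have norm at least one. -/
lemma IsRootEnumeration.one_le_prod (hd : 1 ≤ d) (h : IsRootEnumeration d ξ)
    {z : Fin d → ℤ} (hz : z ≠ 0) :
    1 ≤ ∏ i, |(Matrix.vandermonde ξ).mulVec (fun j => (z j : ℝ)) i| := by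
  set p : MvPolynomial (Fin d) ℤ :=
    ∏ i : Fin d, ∑ j : Fin d, MvPolynomial.X i ^ (j : ℕ) * MvPolynomial.C (z j) with hp
  have hsymm : p.IsSymmetric := by
    intro e
    simp only [hp, map_prod, map_sum, map_mul, map_pow, MvPolynomial.rename_X,
      MvPolynomial.rename_C]
    exact Equiv.prod_comp e
      (fun i => ∑ j : Fin d, MvPolynomial.X i ^ (j : ℕ) * MvPolynomial.C (z j))
  obtain ⟨w, hw⟩ := h.symmetric_int hd hsymm
  have hw' : ∏ i, (Matrix.vandermonde ξ).mulVec (fun j => (z j : ℝ)) i = w := by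
    rw [← hw, hp, map_prod]
    refine Finset.prod_congr rfl fun i _ => ?_
    rw [vandermonde_mulVec_apply]
    simp
  have hne : (w : ℝ) ≠ 0 := by
    rw [← hw']
    exact Finset.prod_ne_zero_iff.2 fun i _ => h.eval_ne_zero hd hz i
  rw [← Finset.abs_prod, hw']
  exact_mod_cast Int.one_le_abs (by exact_mod_cast hne)

lemma finite_setOf_isRootEnumeration (hd : 1 ≤ d) :
    {ξ : Fin d → ℝ | IsRootEnumeration d ξ}.Finite := by
  refine (Set.Finite.pi' (t := fun _ : Fin d => {x | (frolovPoly d).IsRoot x}) fun _ =>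
    Polynomial.finite_setOfPred_isRoot (frolovPoly_monic hd).ne_zero).subset ?_
  exact fun ξ h i => h.2 i

end Enumeration

/-! ### Existence of the real roots -/

lemma prod_odd_sign (k : ℕ) : ∀ d : ℕ, k ≤ d →
    (1 : ℝ) ≤ (-1) ^ (d - k) * ∏ j ∈ Finset.Icc 1 d, (2 * (k : ℝ) - (2 * j - 1)) ∧
    (k + 1 < d →
      (3 : ℝ) ≤ (-1) ^ (d - k) * ∏ j ∈ Finset.Icc 1 d, (2 * (k : ℝ) - (2 * j - 1))) := by
  intro d hkd
  induction d, hkd using Nat.le_induction with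
  | base =>
    refine ⟨?_, fun h => absurd h (by omega)⟩
    rw [Nat.sub_self, pow_zero, one_mul]
    refine Finset.one_le_prod fun j hj => ?_
    have : (j : ℝ) ≤ k := by exact_mod_cast (Finset.mem_Icc.1 hj).2
    linarith
  | succ d hkd ih =>
    rw [Finset.prod_Icc_succ_top (by omega), Nat.sub_add_comm hkd, pow_succ]
    push_cast
    have hk : (k : ℝ) ≤ d := by exact_mod_cast hkd
    refine ⟨by nlinarith [ih.1], fun h => ?_⟩
    have hk' : (k : ℝ) + 1 ≤ d := by exact_mod_cast (show k + 1 ≤ d by omega)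
    nlinarith [ih.1]

lemma eval_frolovPoly (d : ℕ) (x : ℝ) :
    (frolovPoly d).eval x = ∏ j ∈ Finset.Icc 1 d, (x - (2 * j - 1)) - 1 := by
  simp [frolovPoly, Polynomial.eval_prod]

lemma eval_frolovPoly_odd {d j : ℕ} (hj : j ∈ Finset.Icc 1 d) :
    (frolovPoly d).eval (2 * (j : ℝ) - 1) = -1 := by
  rw [eval_frolovPoly, Finset.prod_eq_zero hj] <;> simp

lemma exists_root_frolovPoly {d i : ℕ} (hi : i < d) :
    ∃ x : ℝ, 2 * (i : ℝ) < x ∧ x ≤ 2 * (i : ℝ) + 2 ∧ (frolovPoly d).IsRoot x := by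
  have hodd := eval_frolovPoly_odd (d := d) (j := i + 1) (Finset.mem_Icc.2 (by omega))
  have hcont : Continuous fun x => (frolovPoly d).eval x := (frolovPoly d).continuous
  push_cast at hodd
  rcases Nat.even_or_odd (d - i) with he | ho
  · have h := (prod_odd_sign i d hi.le).2 (by
      obtain ⟨r, hr⟩ := he
      omega)
    rw [he.neg_one_pow, one_mul] at h
    have h0 : 0 < (frolovPoly d).eval (2 * (i : ℝ)) := by rw [eval_frolovPoly]; linarith
    obtain ⟨x, hx, hx0⟩ := intermediate_value_Icc' (a := 2 * (i : ℝ)) (b := 2 * ((i : ℝ) + 1) - 1)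
      (by linarith) hcont.continuousOn (show (0 : ℝ) ∈ _ from ⟨by rw [hodd]; norm_num, h0.le⟩)
    refine ⟨x, lt_of_le_of_ne hx.1 ?_, by linarith [hx.2], hx0⟩
    rintro rfl
    exact h0.ne' hx0
  · have h := (prod_odd_sign (i + 1) d hi).1
    have he : Even (d - (i + 1)) := by
      obtain ⟨r, hr⟩ := ho
      exact ⟨r, by omega⟩
    rw [he.neg_one_pow, one_mul] at h
    push_cast at h
    have h0 : 0 ≤ (frolovPoly d).eval (2 * ((i : ℝ) + 1)) := by rw [eval_frolovPoly]; linarith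
    obtain ⟨x, hx, hx0⟩ := intermediate_value_Icc (a := 2 * ((i : ℝ) + 1) - 1)
      (b := 2 * ((i : ℝ) + 1))
      (by linarith) hcont.continuousOn (show (0 : ℝ) ∈ _ from ⟨by rw [hodd]; norm_num, h0⟩)
    exact ⟨x, by linarith [hx.1], by linarith [hx.2], hx0⟩

lemma exists_isRootEnumeration (d : ℕ) : ∃ ξ : Fin d → ℝ, IsRootEnumeration d ξ := by
  choose ξ h1 h2 h3 using fun i : Fin d => exists_root_frolovPoly i.2
  have hlt : ∀ i j : Fin d, i < j → ξ i < ξ j := fun i j hij => by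
    have : ((i : ℕ) : ℝ) + 1 ≤ (j : ℕ) := by exact_mod_cast hij
    linarith [h2 i, h1 j]
  exact ⟨ξ, StrictMono.injective (fun i j => hlt i j), h3⟩

/-! ### Counting lattice points of norm at least one -/

section Counting

variable {d : ℕ}

lemma card_le_of_mem_box (hd : 1 ≤ d) {ℓ : (Fin d → ℤ) →+ (Fin d → ℝ)}
    (hℓ : ∀ z, z ≠ 0 → 1 ≤ ∏ i, |ℓ z i|) {u w : Fin d → ℝ} (hw : ∀ i, 0 < w i)
    (S : Finset (Fin d → ℤ)) (hS : ∀ z ∈ S, ∀ i, u i ≤ ℓ z i ∧ ℓ z i < u i + w i) :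
    S.card ≤ ⌊∏ i, w i⌋₊ + 1 := by
  set N : ℕ := ⌊∏ i, w i⌋₊ + 1 with hN
  have hNV : ∏ i, w i < N := by exact_mod_cast Nat.lt_floor_add_one (∏ i, w i)
  have hN0 : (0 : ℝ) < N := by positivity
  set i₀ : Fin d := ⟨0, hd⟩
  have hdiv : ∀ z ∈ S, 0 ≤ (ℓ z i₀ - u i₀) * N / w i₀ := fun z hz =>
    div_nonneg (mul_nonneg (by linarith [(hS z hz i₀).1]) hN0.le) (hw i₀).le
  rw [← Finset.card_range N]
  refine Finset.card_le_card_of_injOn (fun z => ⌊(ℓ z i₀ - u i₀) * N / w i₀⌋₊) ?_ ?_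
  · intro z hz
    simp only [Finset.coe_range, Set.mem_Iio]
    rw [Nat.floor_lt (hdiv z hz), div_lt_iff₀ (hw i₀), mul_comm]
    exact mul_lt_mul_of_pos_left (by linarith [(hS z hz i₀).2]) hN0
  · intro z hz z' hz' hzz
    by_contra hne
    have h1 := hℓ (z - z') (sub_ne_zero.2 hne)
    have h2 : ∏ i, |ℓ (z - z') i| ≤ ∏ i, (w i * if i = i₀ then (N : ℝ)⁻¹ else 1) := by
      refine Finset.prod_le_prod (fun i _ => abs_nonneg _) fun i _ => ?_
      rw [map_sub, Pi.sub_apply]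
      split_ifs with hi
      · subst hi
        have h3 : |(ℓ z i₀ - u i₀) * N / w i₀ - (ℓ z' i₀ - u i₀) * N / w i₀| < 1 := by
          have h4 := Nat.floor_le (hdiv z hz)
          have h5 := Nat.lt_floor_add_one ((ℓ z i₀ - u i₀) * N / w i₀)
          have h6 := Nat.floor_le (hdiv z' hz')
          have h7 := Nat.lt_floor_add_one ((ℓ z' i₀ - u i₀) * N / w i₀)
          simp only at hzz
          rw [hzz] at h4 h5
          rw [abs_lt]
          constructor <;> linarith
        rw [← sub_div, ← sub_mul, abs_div, abs_mul, Nat.abs_cast, abs_of_pos (hw _),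
          div_lt_one (hw _), ← lt_div_iff₀ hN0] at h3
        rw [← div_eq_mul_inv]
        refine le_trans (le_of_eq ?_) h3.le
        congr 1
        ring
      · rw [mul_one, abs_le]
        have := hS z hz i
        have := hS z' hz' i
        constructor <;> linarith
    rw [Finset.prod_mul_distrib, Finset.prod_ite_eq' Finset.univ i₀, if_pos (Finset.mem_univ _),
      ← div_eq_mul_inv] at h2
    have h3 : (∏ i, w i) / N < 1 := (div_lt_one hN0).2 hNV
    linarith

lemma card_le_of_sum_eq (hd : 1 ≤ d) {k : ℕ} (R : Finset (Fin d → ℕ))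
    (hR : ∀ r ∈ R, ∑ i, r i = k) : R.card ≤ (k + 1) ^ (d - 1) := by
  obtain ⟨d, rfl⟩ : ∃ d', d = d' + 1 := ⟨d - 1, by omega⟩
  rw [Nat.add_sub_cancel]
  have hc : (Fintype.piFinset fun _ : Fin d => Finset.range (k + 1)).card = (k + 1) ^ d := by
    simp
  rw [← hc]
  refine Finset.card_le_card_of_injOn (fun r i => r (Fin.succ i)) ?_ ?_
  · intro r hr
    simp only [Fintype.coe_piFinset, Finset.coe_range, Set.mem_pi, Set.mem_Iio, Set.mem_univ,
      forall_const]
    intro i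
    have := hR r hr
    have h2 := Finset.single_le_sum (f := r) (fun _ _ => Nat.zero_le _) (Finset.mem_univ i.succ)
    omega
  · intro r hr r' hr' h
    have h1 := hR r hr
    have h2 := hR r' hr'
    rw [Fin.sum_univ_succ] at h1 h2
    have h3 : ∀ i : Fin d, r i.succ = r' i.succ := fun i => congr_fun h i
    simp only [h3] at h1
    funext i
    refine Fin.cases ?_ h3 i
    omega

/-- The dyadic size of a real number: `0` if `|x| < 1`, else the `r` with
`2 ^ (r - 1) ≤ |x| < 2 ^ r`. -/
def dyadicSize (x : ℝ) : ℕ := Nat.size ⌊|x|⌋₊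

lemma abs_lt_two_pow_dyadicSize (x : ℝ) : |x| < 2 ^ dyadicSize x := by
  have h := Nat.lt_size_self ⌊|x|⌋₊
  have := (Nat.floor_lt (abs_nonneg x)).1 h
  exact_mod_cast this

lemma two_pow_dyadicSize_le (x : ℝ) : dyadicSize x = 0 ∨ (2 : ℝ) ^ dyadicSize x ≤ 2 * |x| := by
  rcases Nat.eq_zero_or_pos (dyadicSize x) with h | h
  · exact Or.inl h
  · right
    have h1 : 2 ^ (dyadicSize x - 1) ≤ ⌊|x|⌋₊ := Nat.lt_size.1 (by
      rw [← dyadicSize]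
      omega)
    have h2 := (Nat.le_floor_iff (abs_nonneg x)).1 h1
    push_cast at h2
    calc (2 : ℝ) ^ dyadicSize x = 2 * 2 ^ (dyadicSize x - 1) := by
          rw [← pow_succ', Nat.sub_add_cancel h]
      _ ≤ _ := by linarith

/-- The Sobolev weight `∏_j (1 + |2π x_j|^{2s})`. -/
def sobolevWeight (s : ℕ) (x : Fin d → ℝ) : ℝ := ∏ j, (1 + |2 * Real.pi * x j| ^ (2 * s))

lemma sobolevWeight_pos (s : ℕ) (x : Fin d → ℝ) : 0 < sobolevWeight s x :=
  Finset.prod_pos fun _ _ => by positivity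

lemma inv_sobolevWeight_le (s : ℕ) (x : Fin d → ℝ) :
    (sobolevWeight s x)⁻¹ ≤
      2 ^ (2 * s * d) * ((1 / 2 : ℝ) ^ (2 * s)) ^ (∑ i, dyadicSize (x i)) := by
  have key : (2 : ℝ) ^ (2 * s * ∑ i, dyadicSize (x i)) ≤ 2 ^ (2 * s * d) * sobolevWeight s x := by
    have hc : (2 : ℝ) ^ (2 * s * d) = ∏ _i : Fin d, (2 : ℝ) ^ (2 * s) := by
      simp [pow_mul]
    rw [Finset.mul_sum, ← Finset.prod_pow_eq_pow_sum, hc, sobolevWeight, ← Finset.prod_mul_distrib]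
    refine Finset.prod_le_prod (fun _ _ => by positivity) fun i _ => ?_
    rw [mul_comm (2 * s), pow_mul]
    rcases two_pow_dyadicSize_le (x i) with h | h
    · rw [h, pow_zero, one_pow]
      refine one_le_mul_of_one_le_of_one_le (one_le_pow₀ (by norm_num)) ?_
      have : 0 ≤ |2 * Real.pi * x i| ^ (2 * s) := by positivity
      linarith
    · have h1 : |x i| ≤ |2 * Real.pi * x i| := by
        rw [abs_mul, abs_of_pos (by positivity : 0 < 2 * Real.pi)]
        nlinarith [Real.pi_gt_three, abs_nonneg (x i)]
      calc ((2 : ℝ) ^ dyadicSize (x i)) ^ (2 * s) ≤ (2 * |2 * Real.pi * x i|) ^ (2 * s) := by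
            gcongr
            linarith
        _ = 2 ^ (2 * s) * |2 * Real.pi * x i| ^ (2 * s) := mul_pow _ _ _
        _ ≤ _ := by gcongr; linarith
  rw [← pow_mul, one_div, inv_pow, inv_le_iff_one_le_mul₀ (sobolevWeight_pos s x),
    mul_right_comm, ← div_eq_mul_inv, one_le_div (by positivity)]
  exact key

lemma summable_pow_mul_half (m : ℕ) : Summable fun j : ℕ => ((j : ℝ) + 1) ^ m * (1 / 2) ^ j := by
  have h := summable_pow_mul_geometric_of_norm_lt_one m (r := (1 / 2 : ℝ)) (by norm_num)
  have h2 := ((summable_nat_add_iff 1).2 h).mul_left 2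
  refine h2.congr fun j => ?_
  push_cast
  rw [pow_succ]
  ring

lemma card_dyadic_fiber_le (hd : 1 ≤ d) {ℓ : (Fin d → ℤ) →+ (Fin d → ℝ)}
    (hℓ : ∀ z, z ≠ 0 → 1 ≤ ∏ i, |ℓ z i|) {a : ℝ} (ha : 1 ≤ a) {k : ℕ} (hk : a ^ d ≤ 2 ^ k)
    (S : Finset (Fin d → ℤ)) (hS : ∀ z ∈ S, ∑ i, dyadicSize (a * ℓ z i) = k) :
    (S.card : ℝ) ≤ (2 ^ d + 1) * 2 ^ k / a ^ d * ((k : ℝ) + 1) ^ (d - 1) := by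
  have ha0 : 0 < a := by linarith
  have had : 0 < a ^ d := by positivity
  set r : (Fin d → ℤ) → Fin d → ℕ := fun z i => dyadicSize (a * ℓ z i) with hr
  have hcard : S.card ≤ (⌊2 ^ d * 2 ^ k / a ^ d⌋₊ + 1) * (S.image r).card := by
    refine Finset.card_le_mul_card_image _ _ fun ρ hρ => ?_
    obtain ⟨z₀, hz₀, hρ'⟩ := Finset.mem_image.1 hρ
    have hV : ∏ i, (2 : ℝ) * 2 ^ ρ i / a = 2 ^ d * 2 ^ k / a ^ d := by
      rw [Finset.prod_div_distrib, Finset.prod_mul_distrib, Finset.prod_pow_eq_pow_sum]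
      rw [show ∑ i, ρ i = k by rw [← hρ']; exact hS z₀ hz₀]
      simp
    rw [← hV]
    refine card_le_of_mem_box hd hℓ (u := fun i => -(2 ^ ρ i / a)) (fun i => by positivity) _
      fun z hz i => ?_
    have h1 : r z i = ρ i := by rw [(Finset.mem_filter.1 hz).2]
    have h2 := abs_lt_two_pow_dyadicSize (a * ℓ z i)
    rw [show dyadicSize (a * ℓ z i) = ρ i from h1, abs_mul, abs_of_pos ha0, mul_comm,
      ← lt_div_iff₀ ha0, abs_lt] at h2
    refine ⟨h2.1.le, h2.2.trans_le (le_of_eq ?_)⟩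
    ring
  have himg : (S.image r).card ≤ (k + 1) ^ (d - 1) := by
    refine card_le_of_sum_eq hd _ fun ρ hρ => ?_
    obtain ⟨z₀, hz₀, rfl⟩ := Finset.mem_image.1 hρ
    exact hS z₀ hz₀
  have hfl : ((⌊2 ^ d * 2 ^ k / a ^ d⌋₊ + 1 : ℕ) : ℝ) ≤ (2 ^ d + 1) * 2 ^ k / a ^ d := by
    push_cast
    have h1 := Nat.floor_le (show (0 : ℝ) ≤ 2 ^ d * 2 ^ k / a ^ d by positivity)
    have h2 : (1 : ℝ) ≤ 2 ^ k / a ^ d := (one_le_div had).2 hk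
    calc _ ≤ (2 : ℝ) ^ d * 2 ^ k / a ^ d + 2 ^ k / a ^ d := add_le_add h1 h2
      _ = _ := by ring
  calc (S.card : ℝ) ≤ ((⌊2 ^ d * 2 ^ k / a ^ d⌋₊ + 1 : ℕ) : ℝ) * ((S.image r).card : ℝ) := by
        exact_mod_cast hcard
    _ ≤ _ := by
        gcongr
        exact_mod_cast himg

lemma sum_inv_sobolevWeight_le {s : ℕ} (hs : 1 ≤ s) (hd : 1 ≤ d) :
    ∃ C : ℝ, 0 < C ∧ ∀ ℓ : (Fin d → ℤ) →+ (Fin d → ℝ), (∀ z, z ≠ 0 → 1 ≤ ∏ i, |ℓ z i|) →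
      ∀ a : ℝ, 1 ≤ a → ∀ S : Finset (Fin d → ℤ), (0 ∉ S) →
        ∑ z ∈ S, (sobolevWeight s (fun i => a * ℓ z i))⁻¹ ≤
          C * ((a ^ (s * d))⁻¹) ^ 2 * (1 + Real.log a) ^ (d - 1) := by
  set σ₀ : ℝ := ∑' j : ℕ, ((j : ℝ) + 1) ^ (d - 1) * (1 / 2) ^ j
  have hσ : 0 < σ₀ := (summable_pow_mul_half (d - 1)).tsum_pos (fun j => by positivity) 0
    (by positivity)
  refine ⟨2 ^ (2 * s * d) * (2 ^ d + 1) * (2 * d + 2) ^ (d - 1) * σ₀, by positivity, ?_⟩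
  intro ℓ hℓ a ha S hS
  have ha0 : 0 < a := by linarith
  have had : 1 ≤ a ^ d := one_le_pow₀ ha
  have hlog : 0 ≤ Real.log a := Real.log_nonneg ha
  set K : ℕ := ⌈Real.logb 2 (a ^ d)⌉₊ with hK
  have hK1 : a ^ d ≤ 2 ^ K := by
    have := Nat.le_ceil (Real.logb 2 (a ^ d))
    rw [Real.logb_le_iff_le_rpow (by norm_num) (by positivity), Real.rpow_natCast] at this
    exact this
  have hK2 : (K : ℝ) + 1 ≤ (2 * d + 2) * (1 + Real.log a) := by
    have h1 := (Nat.ceil_lt_add_one (Real.logb_nonneg (b := 2) (by norm_num) had)).le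
    have h2 : Real.logb 2 (a ^ d) ≤ 2 * d * Real.log a := by
      rw [Real.logb, Real.log_pow, div_le_iff₀ (Real.log_pos (by norm_num))]
      have := Real.log_two_gt_d9
      have h3 : 0 ≤ d * Real.log a := by positivity
      nlinarith
    nlinarith
  set ρ : (Fin d → ℤ) → ℕ := fun z => ∑ i, dyadicSize (a * ℓ z i) with hρ
  have hpow : ∀ z ∈ S, a ^ d ≤ 2 ^ ρ z := fun z hz => by
    have h1 := hℓ z (fun h => hS (h ▸ hz))
    have h2 : ∏ i, |a * ℓ z i| ≤ 2 ^ ρ z := by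
      rw [hρ, ← Finset.prod_pow_eq_pow_sum]
      exact Finset.prod_le_prod (fun _ _ => abs_nonneg _) fun i _ =>
        (abs_lt_two_pow_dyadicSize _).le
    simp only [abs_mul, Finset.prod_mul_distrib, abs_of_pos ha0, Finset.prod_const,
      Finset.card_univ, Fintype.card_fin] at h2
    nlinarith
  have hKρ : ∀ z ∈ S, K ≤ ρ z := fun z hz => by
    rw [hK, Nat.ceil_le, Real.logb_le_iff_le_rpow (by norm_num) (by positivity),
      Real.rpow_natCast]
    exact hpow z hz
  set D : ℝ := 2 ^ (2 * s * d) * (2 ^ d + 1) * ((a ^ (s * d))⁻¹) ^ 2 * ((K : ℝ) + 1) ^ (d - 1)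
    with hD
  have hfib : ∀ k ∈ S.image ρ, ∑ z ∈ S with ρ z = k, (sobolevWeight s (fun i => a * ℓ z i))⁻¹ ≤
      D * ((((k - K : ℕ) : ℝ) + 1) ^ (d - 1) * (1 / 2) ^ (k - K)) := by
    intro k hk
    obtain ⟨z₀, hz₀, hzk⟩ := Finset.mem_image.1 hk
    have hKk : K ≤ k := hzk ▸ hKρ z₀ hz₀
    have hkk : a ^ d ≤ 2 ^ k := hzk ▸ hpow z₀ hz₀
    have hc := card_dyadic_fiber_le hd hℓ ha hkk (S.filter fun z => ρ z = k)
      fun z hz => (Finset.mem_filter.1 hz).2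
    have h1 : ∑ z ∈ S with ρ z = k, (sobolevWeight s (fun i => a * ℓ z i))⁻¹ ≤
        ((S.filter fun z => ρ z = k).card : ℝ) *
          (2 ^ (2 * s * d) * ((1 / 2 : ℝ) ^ (2 * s)) ^ k) := by
      rw [← nsmul_eq_mul]
      refine Finset.sum_le_card_nsmul _ _ _ fun z hz => ?_
      have := inv_sobolevWeight_le s (fun i => a * ℓ z i)
      rwa [show ∑ i, dyadicSize (a * ℓ z i) = k from (Finset.mem_filter.1 hz).2] at this
    refine h1.trans ((mul_le_mul_of_nonneg_right hc (by positivity)).trans ?_)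
    obtain ⟨j, rfl⟩ := Nat.exists_eq_add_of_le hKk
    rw [Nat.add_sub_cancel_left]
    obtain ⟨t, rfl⟩ : ∃ t, s = t + 1 := ⟨s - 1, by omega⟩
    have e1 : ((K + j : ℕ) : ℝ) + 1 ≤ ((K : ℝ) + 1) * ((j : ℝ) + 1) := by
      push_cast
      nlinarith [mul_nonneg (Nat.cast_nonneg (α := ℝ) K) (Nat.cast_nonneg (α := ℝ) j)]
    have e2 : (2 : ℝ) ^ (K + j) * ((1 / 2 : ℝ) ^ (2 * (t + 1))) ^ (K + j) ≤
        ((a ^ d) ^ (2 * t + 1))⁻¹ * (1 / 2) ^ j := by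
      have e3 : (2 : ℝ) ^ (K + j) * ((1 / 2 : ℝ) ^ (2 * (t + 1))) ^ (K + j) =
          ((2 ^ K) ^ (2 * t + 1))⁻¹ * ((1 / 2) ^ j) ^ (2 * t + 1) := by
        rw [← mul_pow, show (2 : ℝ) * (1 / 2) ^ (2 * (t + 1)) = (1 / 2) ^ (2 * t + 1) by ring,
          ← pow_mul, ← pow_mul, mul_add, pow_add, ← pow_mul, one_div, inv_pow, mul_comm K,
          mul_comm j]
      rw [e3]
      gcongr
      exact pow_le_of_le_one (by positivity) (pow_le_one₀ (by norm_num) (by norm_num)) (by omega)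
    have e4 : ((a ^ d) ^ (2 * t + 1))⁻¹ / a ^ d = ((a ^ ((t + 1) * d))⁻¹) ^ 2 := by
      rw [div_eq_mul_inv, ← mul_inv, ← pow_succ, ← pow_mul, inv_pow, ← pow_mul]
      congr 2
      ring
    calc (2 ^ d + 1) * 2 ^ (K + j) / a ^ d * (((K + j : ℕ) : ℝ) + 1) ^ (d - 1) *
          (2 ^ (2 * (t + 1) * d) * ((1 / 2 : ℝ) ^ (2 * (t + 1))) ^ (K + j))
        = 2 ^ (2 * (t + 1) * d) * (2 ^ d + 1) * (((K + j : ℕ) : ℝ) + 1) ^ (d - 1) *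
          ((2 ^ (K + j) * ((1 / 2 : ℝ) ^ (2 * (t + 1))) ^ (K + j)) / a ^ d) := by ring
      _ ≤ 2 ^ (2 * (t + 1) * d) * (2 ^ d + 1) * (((K : ℝ) + 1) * ((j : ℝ) + 1)) ^ (d - 1) *
          ((((a ^ d) ^ (2 * t + 1))⁻¹ * (1 / 2) ^ j) / a ^ d) := by gcongr
      _ = 2 ^ (2 * (t + 1) * d) * (2 ^ d + 1) * (((K : ℝ) + 1) * ((j : ℝ) + 1)) ^ (d - 1) *
          ((((a ^ d) ^ (2 * t + 1))⁻¹ / a ^ d) * (1 / 2) ^ j) := by ring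
      _ = _ := by rw [e4, mul_pow, hD]; ring
  have hD0 : 0 ≤ D := by positivity
  calc ∑ z ∈ S, (sobolevWeight s (fun i => a * ℓ z i))⁻¹
      = ∑ k ∈ S.image ρ, ∑ z ∈ S with ρ z = k, (sobolevWeight s (fun i => a * ℓ z i))⁻¹ :=
        (Finset.sum_fiberwise_of_maps_to (fun z hz => Finset.mem_image_of_mem ρ hz) _).symm
    _ ≤ ∑ k ∈ S.image ρ, D * ((((k - K : ℕ) : ℝ) + 1) ^ (d - 1) * (1 / 2) ^ (k - K)) :=
        Finset.sum_le_sum hfib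
    _ = D * ∑ j ∈ (S.image ρ).image (fun k => k - K), (((j : ℝ) + 1) ^ (d - 1) * (1 / 2) ^ j) := by
        rw [Finset.mul_sum, Finset.sum_image (g := fun k => k - K)]
        intro k hk k' hk' h
        obtain ⟨z, hz, rfl⟩ := Finset.mem_image.1 hk
        obtain ⟨z', hz', rfl⟩ := Finset.mem_image.1 hk'
        have := hKρ z hz
        have := hKρ z' hz'
        simp only [] at h
        omega
    _ ≤ D * σ₀ := by
        gcongr
        exact (summable_pow_mul_half (d - 1)).sum_le_tsum _ fun j _ => by positivity
    _ ≤ 2 ^ (2 * s * d) * (2 ^ d + 1) * ((a ^ (s * d))⁻¹) ^ 2 *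
          ((2 * d + 2) * (1 + Real.log a)) ^ (d - 1) * σ₀ := by
        rw [hD]
        gcongr
    _ = _ := by rw [mul_pow]; ring

end Counting

/-! ### Fourier series on the torus: unfolding, Bessel and Poisson -/

section Torus

open UnitAddTorus

/-- The normalised measure on `ℝ / ℤ` used for multivariate Fourier series. -/
local instance unitCircleMeasureSpace : MeasureSpace UnitAddCircle := ⟨AddCircle.haarAddCircle⟩

local instance unitCircleHaar : Measure.IsAddHaarMeasure (volume : Measure UnitAddCircle) :=
  inferInstanceAs (Measure.IsAddHaarMeasure AddCircle.haarAddCircle)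

local instance unitCircleProbability : IsProbabilityMeasure (volume : Measure UnitAddCircle) :=
  inferInstanceAs (IsProbabilityMeasure AddCircle.haarAddCircle)

variable {d : ℕ}

/-- The half-open box `(0,1]^d`, a fundamental domain of `ℤ^d`. -/
def unitBox (d : ℕ) : Set (Fin d → ℝ) :=
  {x | ∀ i, x i ∈ Set.Ioc ((0 : Fin d → ℝ) i) ((0 : Fin d → ℝ) i + 1)}

lemma measurableSet_unitBox : MeasurableSet (unitBox d) :=
  MeasurableSet.univ_pi' fun _ => measurableSet_Ioc

/-- The representative in `(0,1]^d` of a point of the torus. -/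
def torusRepr (t : UnitAddTorus (Fin d)) : Fin d → ℝ := (measurableEquivPiIoc 0 t).1

lemma torusRepr_mem (t : UnitAddTorus (Fin d)) : torusRepr t ∈ unitBox d :=
  (measurableEquivPiIoc 0 t).2

lemma torusRepr_coe {x : Fin d → ℝ} (hx : x ∈ unitBox d) :
    torusRepr (fun i => (x i : UnitAddCircle)) = x :=
  congr_arg Subtype.val ((measurableEquivPiIoc 0).apply_symm_apply ⟨x, hx⟩)

lemma measurePreserving_torusRepr :
    MeasurePreserving (torusRepr (d := d)) volume (volume.restrict (unitBox d)) :=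
  (measurePreserving_subtype_coe measurableSet_unitBox).comp (measurePreserving_equivPiIoc 0)

lemma mFourier_coe_add_int (m k : Fin d → ℤ) (y : Fin d → ℝ) :
    mFourier m (fun i => ((y i + k i : ℝ) : UnitAddCircle)) =
      mFourier m (fun i => (y i : UnitAddCircle)) := by
  congr 1
  funext i
  rw [AddCircle.coe_add]
  have : ((k i : ℝ) : UnitAddCircle) = 0 := by
    rw [AddCircle.coe_eq_zero_iff]
    exact ⟨k i, by simp⟩
  rw [this, add_zero]

/-- Translation of the unit box by an integer vector. -/
def intBox (k : Fin d → ℤ) : Set (Fin d → ℝ) := {y | (fun i => y i - k i) ∈ unitBox d}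

lemma measurableSet_intBox (k : Fin d → ℤ) : MeasurableSet (intBox k) :=
  measurableSet_unitBox.preimage (by fun_prop)

lemma pairwise_disjoint_intBox : Pairwise (Function.onFun Disjoint (intBox (d := d))) := by
  intro k k' hkk
  refine Set.disjoint_left.2 fun y hy hy' => hkk ?_
  funext i
  have h1 := hy i
  have h2 := hy' i
  simp only [Pi.zero_apply, zero_add, Set.mem_Ioc] at h1 h2
  have h3 : (k i : ℝ) < k' i + 1 := by linarith
  have h4 : (k' i : ℝ) < k i + 1 := by linarith
  have h5 : k i < k' i + 1 := by exact_mod_cast h3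
  have h6 : k' i < k i + 1 := by exact_mod_cast h4
  omega

lemma setIntegral_unitBox_add {E : Type*} [NormedAddCommGroup E] [NormedSpace ℝ E]
    (k : Fin d → ℤ) (φ : (Fin d → ℝ) → E) :
    ∫ x in unitBox d, φ (fun i => x i + k i) = ∫ y in intBox k, φ y := by
  have h : MeasurePreserving (fun x : Fin d → ℝ => x + fun i => (k i : ℝ)) volume volume :=
    measurePreserving_add_right volume _
  have he : MeasurableEmbedding (fun x : Fin d → ℝ => x + fun i => (k i : ℝ)) :=
    (MeasurableEquiv.addRight _).measurableEmbedding
  rw [← h.setIntegral_preimage_emb he φ (intBox k)]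
  have hpre : (fun x : Fin d → ℝ => x + fun i => (k i : ℝ)) ⁻¹' intBox k = unitBox d := by
    ext x
    simp only [intBox, Set.mem_preimage, Set.mem_ofPred_eq, Pi.add_apply, add_sub_cancel_right]
  rw [hpre]
  rfl

/-- The integer vectors `k` whose boxes can meet `[-N,N]^d`. -/
def boxIndices (d N : ℕ) : Finset (Fin d → ℤ) :=
  Fintype.piFinset fun _ => Finset.Icc (-(N : ℤ) - 1) N

lemma card_boxIndices (d N : ℕ) : (boxIndices d N).card = (2 * N + 2) ^ d := by
  simp only [boxIndices, Fintype.card_piFinset, Int.card_Icc, Finset.prod_const, Finset.card_univ,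
    Fintype.card_fin]
  congr 1
  omega

lemma mem_boxIndices {N : ℕ} {k : Fin d → ℤ} {y : Fin d → ℝ} (hy : ∀ i, |y i| ≤ N)
    (hk : y ∈ intBox k) : k ∈ boxIndices d N := by
  refine Fintype.mem_piFinset.2 fun i => Finset.mem_Icc.2 ?_
  have h1 := hk i
  have h2 := abs_le.1 (hy i)
  simp only [Pi.zero_apply, zero_add, Set.mem_Ioc] at h1
  constructor
  · have : (-(N : ℤ) - 1 : ℝ) ≤ k i := by push_cast; linarith
    exact_mod_cast this
  · have : (k i : ℝ) ≤ N := by linarith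
    exact_mod_cast this

lemma exists_mem_intBox (y : Fin d → ℝ) : ∃ k : Fin d → ℤ, y ∈ intBox k := by
  refine ⟨fun i => ⌈y i⌉ - 1, fun i => ?_⟩
  have h1 := Int.le_ceil (y i)
  have h2 := Int.ceil_lt_add_one (y i)
  simp only [Pi.zero_apply, zero_add, Set.mem_Ioc]
  push_cast
  constructor <;> linarith

variable {H : (Fin d → ℝ) → ℂ} {N : ℕ}

/-- A piece of `H`, as a function on the torus. -/
def torusPiece (H : (Fin d → ℝ) → ℂ) (k : Fin d → ℤ) (t : UnitAddTorus (Fin d)) : ℂ :=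
  H (fun i => torusRepr t i + k i)

lemma mFourierCoeff_torusPiece (k m : Fin d → ℤ) :
    mFourierCoeff (torusPiece H k) m =
      ∫ y in intBox k, mFourier (-m) (fun i => (y i : UnitAddCircle)) * H y := by
  rw [mFourierCoeff_eq_integral _ _ 0, ← setIntegral_unitBox_add]
  refine setIntegral_congr_fun measurableSet_unitBox fun x hx => ?_
  simp only [torusPiece, torusRepr_coe hx, mFourier_coe_add_int, smul_eq_mul]

lemma integrable_mFourier_mul (hH : Integrable H) (m : Fin d → ℤ) :
    Integrable fun y => mFourier m (fun i => (y i : UnitAddCircle)) * H y := by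
  refine hH.bdd_mul (c := 1) (Continuous.aestronglyMeasurable ?_) (Eventually.of_forall fun y => ?_)
  · exact (mFourier m).continuous.comp
      (continuous_pi fun i => (AddCircle.continuous_mk' 1).comp (continuous_apply i))
  · exact ((mFourier m).norm_coe_le_norm _).trans mFourier_norm.le

/-- Unfolding: the Fourier transform at integers as a sum of Fourier coefficients. -/
lemma integral_mFourier_mul_eq_sum (hH : Integrable H) (hN : ∀ y, H y ≠ 0 → ∀ i, |y i| ≤ N)
    (m : Fin d → ℤ) :
    ∫ y, mFourier (-m) (fun i => (y i : UnitAddCircle)) * H y =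
      ∑ k ∈ boxIndices d N, mFourierCoeff (torusPiece H k) m := by
  simp only [mFourierCoeff_torusPiece]
  rw [← integral_biUnion_finset _ (fun k _ => measurableSet_intBox k)
    (fun k _ k' _ h => pairwise_disjoint_intBox h)
    (fun k _ => (integrable_mFourier_mul hH (-m)).integrableOn)]
  refine (setIntegral_eq_integral_of_forall_compl_eq_zero fun y hy => ?_).symm
  by_contra h
  obtain ⟨k, hk⟩ := exists_mem_intBox y
  exact hy (Set.mem_iUnion₂.2 ⟨k, mem_boxIndices (hN y (right_ne_zero_of_mul h)) hk, hk⟩)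

lemma sum_norm_sq_mFourierCoeff_le {g : UnitAddTorus (Fin d) → ℂ} (hg : MemLp g 2)
    (S : Finset (Fin d → ℤ)) :
    ∑ m ∈ S, ‖mFourierCoeff g m‖ ^ 2 ≤ ∫ t, ‖g t‖ ^ 2 := by
  have h := hasSum_sq_mFourierCoeff (hg.toLp g)
  have h1 : ∀ m, mFourierCoeff (hg.toLp g) m = mFourierCoeff g m := fun m =>
    integral_congr_ae (by filter_upwards [hg.coeFn_toLp] with t ht; rw [ht])
  have h2 : ∫ t, ‖(hg.toLp g) t‖ ^ 2 = ∫ t, ‖g t‖ ^ 2 :=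
    integral_congr_ae (by filter_upwards [hg.coeFn_toLp] with t ht; rw [ht])
  simp only [h1, h2] at h
  exact sum_le_hasSum S (fun _ _ => by positivity) h

lemma memLp_torusPiece (hH : MemLp H 2) (k : Fin d → ℤ) : MemLp (torusPiece H k) 2 := by
  have h1 : MemLp (fun x : Fin d → ℝ => H (x + fun i => (k i : ℝ))) 2 volume :=
    hH.comp_measurePreserving (measurePreserving_add_right volume _)
  exact (h1.restrict (unitBox d)).comp_measurePreserving measurePreserving_torusRepr

lemma integral_norm_sq_torusPiece (k : Fin d → ℤ) :
    ∫ t, ‖torusPiece H k t‖ ^ 2 = ∫ y in intBox k, ‖H y‖ ^ 2 := by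
  rw [integral_preimage _ 0, ← setIntegral_unitBox_add]
  refine setIntegral_congr_fun measurableSet_unitBox fun x hx => ?_
  simp only [torusPiece, torusRepr_coe hx]

/-- Bessel's inequality for functions supported in `[-N,N]^d`. -/
lemma sum_norm_sq_integral_mFourier_le (hH : Integrable H) (hH2 : MemLp H 2)
    (hN : ∀ y, H y ≠ 0 → ∀ i, |y i| ≤ N) (S : Finset (Fin d → ℤ)) :
    ∑ m ∈ S, ‖∫ y, mFourier (-m) (fun i => (y i : UnitAddCircle)) * H y‖ ^ 2 ≤
      (2 * N + 2) ^ d * ∫ y, ‖H y‖ ^ 2 := by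
  have hint : Integrable fun y => ‖H y‖ ^ 2 := hH2.integrable_norm_pow (by norm_num)
  calc ∑ m ∈ S, ‖∫ y, mFourier (-m) (fun i => (y i : UnitAddCircle)) * H y‖ ^ 2
      ≤ ∑ m ∈ S, ((2 * N + 2 : ℕ) ^ d : ℕ) *
          ∑ k ∈ boxIndices d N, ‖mFourierCoeff (torusPiece H k) m‖ ^ 2 := by
        refine Finset.sum_le_sum fun m _ => ?_
        rw [integral_mFourier_mul_eq_sum hH hN, ← card_boxIndices]
        refine (pow_le_pow_left₀ (norm_nonneg _) (norm_sum_le _ _) 2).trans ?_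
        exact sq_sum_le_card_mul_sum_sq
    _ = ((2 * N + 2 : ℕ) ^ d : ℕ) * ∑ k ∈ boxIndices d N,
          ∑ m ∈ S, ‖mFourierCoeff (torusPiece H k) m‖ ^ 2 := by
        rw [← Finset.mul_sum, Finset.sum_comm]
    _ ≤ ((2 * N + 2 : ℕ) ^ d : ℕ) * ∑ k ∈ boxIndices d N, ∫ y in intBox k, ‖H y‖ ^ 2 := by
        gcongr with k _
        rw [← integral_norm_sq_torusPiece]
        exact sum_norm_sq_mFourierCoeff_le (memLp_torusPiece hH2 k) S
    _ ≤ _ := by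
        rw [← integral_biUnion_finset _ (fun k _ => measurableSet_intBox k)
          (fun k _ k' _ h => pairwise_disjoint_intBox h) (fun k _ => hint.integrableOn)]
        push_cast
        refine mul_le_mul_of_nonneg_left ?_ (by positivity)
        exact setIntegral_le_integral hint (Eventually.of_forall fun y => by positivity)

/-- The `ℤ^d`-periodization of a function. -/
def periodization (H : (Fin d → ℝ) → ℂ) (y : Fin d → ℝ) : ℂ :=
  ∑ᶠ k : Fin d → ℤ, H (fun i => y i + k i)

lemma continuous_periodization (hc : Continuous H) (hN : ∀ y, H y ≠ 0 → ∀ i, |y i| ≤ N) :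
    Continuous (periodization H) := by
  refine continuous_finsum (fun k => hc.comp (by fun_prop)) fun y₀ => ?_
  refine ⟨Metric.ball y₀ 1, Metric.ball_mem_nhds _ one_pos, ?_⟩
  refine (Set.Finite.pi' (t := fun i : Fin d => Set.Icc ⌊-(N : ℝ) - |y₀ i| - 1⌋
    ⌈(N : ℝ) + |y₀ i| + 1⌉) fun i => Set.finite_Icc _ _).subset ?_
  rintro k ⟨y, hy, hyb⟩ i
  have h1 := abs_le.1 (hN _ hy i)
  have h2 : |y i - y₀ i| < 1 := (Real.dist_eq _ _ ▸ dist_le_pi_dist y y₀ i).trans_lt hyb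
  have h3 := abs_lt.1 h2
  have h4 := neg_abs_le (y₀ i)
  have h5 := le_abs_self (y₀ i)
  constructor
  · have := Int.floor_le (-(N : ℝ) - |y₀ i| - 1)
    have h6 : (⌊-(N : ℝ) - |y₀ i| - 1⌋ : ℝ) ≤ k i := by linarith
    exact_mod_cast h6
  · have := Int.le_ceil ((N : ℝ) + |y₀ i| + 1)
    have h6 : (k i : ℝ) ≤ ⌈(N : ℝ) + |y₀ i| + 1⌉ := by linarith
    exact_mod_cast h6

lemma periodization_add_int (y : Fin d → ℝ) (l : Fin d → ℤ) :
    periodization H (fun i => y i + l i) = periodization H y := by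
  unfold periodization
  refine Eq.trans (finsum_congr fun k => ?_) (finsum_comp_equiv (Equiv.addLeft l))
  congr 1
  funext i
  simp [add_assoc]

lemma periodization_torusRepr_coe (y : Fin d → ℝ) :
    periodization H (torusRepr fun i => (y i : UnitAddCircle)) = periodization H y := by
  obtain ⟨k, hk⟩ := exists_mem_intBox y
  have h : (fun i => (y i : UnitAddCircle)) = fun i => ((y i - k i : ℝ) : UnitAddCircle) := by
    funext i
    rw [AddCircle.coe_sub]
    have : ((k i : ℝ) : UnitAddCircle) = 0 := by
      rw [AddCircle.coe_eq_zero_iff]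
      exact ⟨k i, by simp⟩
    rw [this, sub_zero]
  rw [h, torusRepr_coe hk, ← periodization_add_int _ k]
  simp

/-- The periodization as a continuous function on the torus. -/
def torusPeriodization (hc : Continuous H) (hN : ∀ y, H y ≠ 0 → ∀ i, |y i| ≤ N) :
    C(UnitAddTorus (Fin d), ℂ) where
  toFun t := periodization H (torusRepr t)
  continuous_toFun := by
    have hq : IsOpenQuotientMap
        (Pi.map fun (_ : Fin d) (x : ℝ) => (x : UnitAddCircle)) :=
      IsOpenQuotientMap.piMap fun _ => QuotientAddGroup.isOpenQuotientMap_mk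
    refine hq.isQuotientMap.continuous_iff.2 ?_
    exact (continuous_periodization hc hN).congr fun y => (periodization_torusRepr_coe y).symm

lemma torusPeriodization_eq_sum (hc : Continuous H) (hN : ∀ y, H y ≠ 0 → ∀ i, |y i| ≤ N)
    (t : UnitAddTorus (Fin d)) :
    torusPeriodization hc hN t = ∑ k ∈ boxIndices d N, torusPiece H k t := by
  refine finsum_eq_sum_of_support_subset _ fun k hk => ?_
  refine mem_boxIndices (hN _ hk) ?_
  simpa [intBox] using torusRepr_mem t

/-- Poisson summation. -/
lemma hasSum_integral_mFourier_mul (hc : Continuous H) (hH : Integrable H) (hH2 : MemLp H 2)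
    (hN : ∀ y, H y ≠ 0 → ∀ i, |y i| ≤ N)
    (hs : Summable fun m : Fin d → ℤ =>
      ∫ y, mFourier (-m) (fun i => (y i : UnitAddCircle)) * H y) :
    HasSum (fun m : Fin d → ℤ => ∫ y, mFourier (-m) (fun i => (y i : UnitAddCircle)) * H y)
      (∑ᶠ k : Fin d → ℤ, H (fun i => (k i : ℝ))) := by
  have hcoeff : ∀ m, mFourierCoeff (torusPeriodization hc hN) m =
      ∫ y, mFourier (-m) (fun i => (y i : UnitAddCircle)) * H y := by
    intro m
    rw [integral_mFourier_mul_eq_sum hH hN]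
    unfold mFourierCoeff
    rw [← integral_finsetSum]
    · simp only [torusPeriodization_eq_sum, Finset.smul_sum]
    · intro k _
      have h1 : Integrable (torusPiece H k) := (memLp_torusPiece hH2 k).integrable (by norm_num)
      refine h1.bdd_smul (C := 1) (mFourier (-m)).continuous.aestronglyMeasurable
        (Eventually.of_forall fun y => ?_)
      exact ((mFourier (-m)).norm_coe_le_norm _).trans mFourier_norm.le
  have h := hasSum_mFourier_series_apply_of_summable (f := torusPeriodization hc hN)
    (by simpa only [← hcoeff] using! hs) (fun i => ((0 : ℝ) : UnitAddCircle))
  have hval : torusPeriodization hc hN (fun i => ((0 : ℝ) : UnitAddCircle)) =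
      ∑ᶠ k : Fin d → ℤ, H (fun i => (k i : ℝ)) := by
    refine (periodization_torusRepr_coe (fun _ => (0 : ℝ))).trans ?_
    simp [periodization]
  rw [hval] at h
  refine h.congr_fun fun m => ?_
  rw [← hcoeff]
  simp [mFourier]

lemma mFourier_neg_coe (m : Fin d → ℤ) (y : Fin d → ℝ) :
    mFourier (-m) (fun i => (y i : UnitAddCircle)) =
      Complex.exp (((-(2 * Real.pi * ∑ i, (m i : ℝ) * y i) : ℝ) : ℂ) * Complex.I) := by
  simp only [mFourier, ContinuousMap.coe_mk, fourier_coe_apply, ← Complex.exp_sum]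
  congr 1
  push_cast
  rw [Finset.mul_sum, ← Finset.sum_neg_distrib, Finset.sum_mul]
  refine Finset.sum_congr rfl fun i _ => ?_
  simp
  ring

end Torus

section FourierTransform

variable {d : ℕ}

/-- The Fourier transform of a real function on `ℝ^d`. -/
def fourierInt (h : (Fin d → ℝ) → ℝ) (ω : Fin d → ℝ) : ℂ :=
  ∫ x, Complex.exp (((-(2 * Real.pi * ∑ i, ω i * x i) : ℝ) : ℂ) * Complex.I) * (h x : ℂ)

lemma map_inv_mulVec_volume {M : Matrix (Fin d) (Fin d) ℝ} (hM : M.det ≠ 0) :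
    Measure.map (fun y => M⁻¹.mulVec y) volume = ENNReal.ofReal |M.det| • volume := by
  have h := Real.map_matrix_volume_pi_eq_smul_volume_pi (M := M⁻¹) (by
    rw [Matrix.det_nonsing_inv, Ring.inverse_eq_inv']
    exact inv_ne_zero hM)
  rw [Matrix.det_nonsing_inv, Ring.inverse_eq_inv', inv_inv] at h
  exact h

lemma measurable_mulVec (M : Matrix (Fin d) (Fin d) ℝ) : Measurable fun y => M.mulVec y :=
  (Continuous.matrix_mulVec continuous_const continuous_id).measurable

lemma inv_mulVec_mulVec {M : Matrix (Fin d) (Fin d) ℝ} (hM : M.det ≠ 0) (y : Fin d → ℝ) :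
    M⁻¹.mulVec (M.mulVec y) = y := by
  rw [Matrix.mulVec_mulVec, Matrix.nonsing_inv_mul _ (isUnit_iff_ne_zero.2 hM), Matrix.one_mulVec]

lemma mulVec_inv_mulVec {M : Matrix (Fin d) (Fin d) ℝ} (hM : M.det ≠ 0) (y : Fin d → ℝ) :
    M.mulVec (M⁻¹.mulVec y) = y := by
  rw [Matrix.mulVec_mulVec, Matrix.mul_nonsing_inv _ (isUnit_iff_ne_zero.2 hM), Matrix.one_mulVec]

lemma integral_comp_inv_mulVec {E : Type*} [NormedAddCommGroup E] [NormedSpace ℝ E]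
    {M : Matrix (Fin d) (Fin d) ℝ} (hM : M.det ≠ 0) (φ : (Fin d → ℝ) → E) :
    ∫ y, φ (M⁻¹.mulVec y) = |M.det| • ∫ x, φ x := by
  let e : (Fin d → ℝ) ≃ᵐ (Fin d → ℝ) :=
    { toFun := fun y => M⁻¹.mulVec y
      invFun := fun y => M.mulVec y
      left_inv := mulVec_inv_mulVec hM
      right_inv := inv_mulVec_mulVec hM
      measurable_toFun := measurable_mulVec _
      measurable_invFun := measurable_mulVec _ }
  have h := integral_map_equiv (μ := volume) e φ
  rw [show Measure.map e volume = _ from map_inv_mulVec_volume hM, integral_smul_measure,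
    ENNReal.toReal_ofReal (abs_nonneg _)] at h
  exact h.symm

variable {M : Matrix (Fin d) (Fin d) ℝ} {h : (Fin d → ℝ) → ℝ} {N : ℕ}

lemma memLp_comp_inv_mulVec (hM : M.det ≠ 0) {p : ℝ≥0∞} (hh : MemLp h p) :
    MemLp (fun y => (h (M⁻¹.mulVec y) : ℂ)) p := by
  refine MemLp.ofReal ?_
  refine MemLp.comp_of_map (f := fun y => M⁻¹.mulVec y) (g := h) ?_ (measurable_mulVec _).aemeasurable
  rw [map_inv_mulVec_volume hM]
  exact hh.smul_measure ENNReal.ofReal_ne_top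

lemma integral_mFourier_comp_inv_mulVec (hM : M.det ≠ 0) (h : (Fin d → ℝ) → ℝ) (m : Fin d → ℤ) :
    ∫ y, UnitAddTorus.mFourier (-m) (fun i => (y i : UnitAddCircle)) *
      (h (M⁻¹.mulVec y) : ℂ) =
      |M.det| * fourierInt h (M.transpose.mulVec fun i => (m i : ℝ)) := by
  have e := integral_comp_inv_mulVec hM (fun x =>
    Complex.exp (((-(2 * Real.pi * ∑ i, (m i : ℝ) * M.mulVec x i) : ℝ) : ℂ) * Complex.I) *
      (h x : ℂ))
  simp only [mulVec_inv_mulVec hM] at e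
  simp only [mFourier_neg_coe]
  rw [e, Complex.real_smul]
  congr 2
  funext x
  have : ∑ i, (m i : ℝ) * M.mulVec x i =
      ∑ i, M.transpose.mulVec (fun i => (m i : ℝ)) i * x i := by
    have := Matrix.dotProduct_mulVec (fun i => (m i : ℝ)) M x
    rw [← Matrix.mulVec_transpose] at this
    exact this
  rw [this]

lemma sum_norm_sq_fourierInt_le (hM : M.det ≠ 0) (hh : Integrable h) (hh2 : MemLp h 2)
    (hcube : ∀ x, h x ≠ 0 → x ∈ cube d) (hN : ∀ x ∈ cube d, ∀ i, |M.mulVec x i| ≤ N)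
    (S : Finset (Fin d → ℤ)) :
    ∑ m ∈ S, ‖fourierInt h (M.transpose.mulVec fun i => (m i : ℝ))‖ ^ 2 ≤
      (2 * N + 2) ^ d / |M.det| * ∫ x, h x ^ 2 := by
  have hdet : 0 < |M.det| := abs_pos.2 hM
  have hB := sum_norm_sq_integral_mFourier_le (N := N)
    (memLp_one_iff_integrable.1 (memLp_comp_inv_mulVec hM (memLp_one_iff_integrable.2 hh)))
    (memLp_comp_inv_mulVec hM hh2) (fun y hy i => by
      have := hN _ (hcube _ (by exact_mod_cast hy)) i
      rwa [mulVec_inv_mulVec hM] at this) S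
  simp only [integral_mFourier_comp_inv_mulVec hM, norm_mul, Complex.norm_real, mul_pow,
    ← Finset.mul_sum, Real.norm_eq_abs, abs_abs, sq_abs] at hB
  rw [integral_comp_inv_mulVec hM (fun x => h x ^ 2), smul_eq_mul] at hB
  have e : (2 * (N : ℝ) + 2) ^ d / |M.det| * ∫ x, h x ^ 2 =
      ((2 * (N : ℝ) + 2) ^ d * (|M.det| * ∫ x, h x ^ 2)) / M.det ^ 2 := by
    rw [← sq_abs M.det]
    field_simp
  rw [e, le_div_iff₀ (by positivity), mul_comm]
  exact hB

lemma hasSum_fourierInt (hM : M.det ≠ 0) (hc : Continuous h) (hh : Integrable h)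
    (hh2 : MemLp h 2) (hcube : ∀ x, h x ≠ 0 → x ∈ cube d)
    (hN : ∀ x ∈ cube d, ∀ i, |M.mulVec x i| ≤ N)
    (hs : Summable fun m : Fin d → ℤ => fourierInt h (M.transpose.mulVec fun i => (m i : ℝ))) :
    HasSum (fun m : Fin d → ℤ => fourierInt h (M.transpose.mulVec fun i => (m i : ℝ)))
      (((|M.det|)⁻¹ * ∑ᶠ k : Fin d → ℤ, h (M⁻¹.mulVec fun i => (k i : ℝ)) : ℝ) : ℂ) := by
  have hdet : ((|M.det| : ℝ) : ℂ) ≠ 0 := by exact_mod_cast (abs_pos.2 hM).ne'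
  have hP := hasSum_integral_mFourier_mul (N := N) (H := fun y => (h (M⁻¹.mulVec y) : ℂ))
    (Complex.continuous_ofReal.comp
      (hc.comp (Continuous.matrix_mulVec continuous_const continuous_id)))
    (memLp_one_iff_integrable.1 (memLp_comp_inv_mulVec hM (memLp_one_iff_integrable.2 hh)))
    (memLp_comp_inv_mulVec hM hh2) (fun y hy i => by
      have := hN _ (hcube _ (by exact_mod_cast hy)) i
      rwa [mulVec_inv_mulVec hM] at this)
  simp only [integral_mFourier_comp_inv_mulVec hM] at hP
  have h2 := (hP (hs.mul_left _)).mul_left (((|M.det| : ℝ) : ℂ)⁻¹)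
  simp only [inv_mul_cancel_left₀ hdet] at h2
  rw [Complex.ofReal_mul, Complex.ofReal_inv,
    show ((∑ᶠ k : Fin d → ℤ, h (M⁻¹.mulVec fun i => (k i : ℝ)) : ℝ) : ℂ) =
      ∑ᶠ k : Fin d → ℤ, (h (M⁻¹.mulVec fun i => (k i : ℝ)) : ℂ) from
      Complex.ofRealHom.toAddMonoidHom.map_finsum_of_injective Complex.ofReal_injective _]
  exact h2

end FourierTransform

/-! ### Weak derivatives and the Fourier transform -/

section WeakDerivative

variable {d : ℕ}

lemma mixedPartial_rel {R : ((Fin d → ℝ) → ℝ) → ((Fin d → ℝ) → ℝ) → Prop}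
    (hR : ∀ i f g, R f g → R (partialDeriv i f) (partialDeriv i g)) (α : Fin d → ℕ)
    {f g : (Fin d → ℝ) → ℝ} (h : R f g) : R (mixedPartial α f) (mixedPartial α g) := by
  have hit : ∀ (i : Fin d) (k : ℕ) f g, R f g → R ((partialDeriv i)^[k] f) ((partialDeriv i)^[k] g) := by
    intro i k
    induction k with
    | zero => exact fun f g h => h
    | succ k ih =>
      intro f g h
      rw [Function.iterate_succ_apply, Function.iterate_succ_apply]
      exact ih _ _ (hR i f g h)
  unfold mixedPartial
  induction List.finRange d with
  | nil => exact h
  | cons i l ih => exact hit i _ _ _ ih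

lemma mixedPartial_eqOn {U : Set (Fin d → ℝ)} (hU : IsOpen U) (α : Fin d → ℕ)
    {f g : (Fin d → ℝ) → ℝ} (h : Set.EqOn f g U) :
    Set.EqOn (mixedPartial α f) (mixedPartial α g) U := by
  refine mixedPartial_rel (R := fun f g => Set.EqOn f g U) (fun i f g hfg x hx => ?_) α h
  have : f =ᶠ[𝓝 x] g := hfg.eventuallyEq_of_mem (hU.mem_nhds hx)
  simp only [partialDeriv, this.fderiv_eq]

lemma aestronglyMeasurable_mixedPartial {μ : Measure (Fin d → ℝ)} (α : Fin d → ℕ)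
    {f : (Fin d → ℝ) → ℝ} (h : AEStronglyMeasurable f μ) :
    AEStronglyMeasurable (mixedPartial α f) μ := by
  refine mixedPartial_rel (R := fun f _ => AEStronglyMeasurable f μ) (fun i f _ _ => ?_) α
    (g := f) h
  exact (measurable_fderiv_apply_const ℝ f (Pi.single i 1)).aestronglyMeasurable

/-- The plane wave `cos(2π ω·x + θ)`. -/
def wave (ω : Fin d → ℝ) (θ : ℝ) (x : Fin d → ℝ) : ℝ :=
  Real.cos (2 * Real.pi * ∑ i, ω i * x i + θ)

lemma contDiff_wave (ω : Fin d → ℝ) (θ : ℝ) {n : WithTop ℕ∞} : ContDiff ℝ n (wave ω θ) := by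
  unfold wave
  exact Real.contDiff_cos.comp (by fun_prop)

lemma partialDeriv_wave (ω : Fin d → ℝ) (θ c : ℝ) (i : Fin d) :
    partialDeriv i (fun x => c * wave ω θ x) =
      fun x => (c * (2 * Real.pi * ω i)) * wave ω (θ + Real.pi / 2) x := by
  funext x
  have h1 : HasFDerivAt (fun x : Fin d → ℝ => 2 * Real.pi * ∑ i, ω i * x i + θ)
      ((2 * Real.pi) • ∑ i, ω i • ContinuousLinearMap.proj (R := ℝ) (φ := fun _ : Fin d => ℝ) i) x := by
    refine HasFDerivAt.add_const θ (HasFDerivAt.const_mul ?_ _)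
    refine HasFDerivAt.fun_sum fun j _ => ?_
    exact (ContinuousLinearMap.proj (R := ℝ) (φ := fun _ : Fin d => ℝ) j).hasFDerivAt.const_mul _
  have h2 := (h1.cos).const_mul c
  unfold partialDeriv wave
  rw [h2.fderiv, ← add_assoc, Real.cos_add_pi_div_two]
  simp [Pi.single_apply]
  ring

lemma mixedPartial_wave (ω : Fin d → ℝ) (θ : ℝ) (α : Fin d → ℕ) :
    mixedPartial α (wave ω θ) = fun x => (∏ i, (2 * Real.pi * ω i) ^ α i) *
      wave ω (θ + ((∑ i, α i : ℕ) : ℝ) * (Real.pi / 2)) x := by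
  have hit : ∀ (i : Fin d) (k : ℕ) (c θ : ℝ), (partialDeriv i)^[k] (fun x => c * wave ω θ x) =
      fun x => (c * (2 * Real.pi * ω i) ^ k) * wave ω (θ + k * (Real.pi / 2)) x := by
    intro i k
    induction k with
    | zero => intro c θ; simp
    | succ k ih =>
      intro c θ
      rw [Function.iterate_succ_apply, partialDeriv_wave, ih]
      funext x
      rw [pow_succ]
      push_cast
      congr 1
      · ring
      · congr 1; ring
  have hl : ∀ l : List (Fin d), l.foldr (fun i g => (partialDeriv i)^[α i] g) (wave ω θ) =
      fun x => (l.map fun i => (2 * Real.pi * ω i) ^ α i).prod *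
        wave ω (θ + ((l.map α).sum : ℕ) * (Real.pi / 2)) x := by
    intro l
    induction l with
    | nil => simp
    | cons i l ih =>
      rw [List.foldr_cons, ih, hit]
      funext x
      rw [List.map_cons, List.prod_cons, List.map_cons, List.sum_cons]
      push_cast
      congr 1
      · ring
      · congr 1; ring
  rw [mixedPartial, hl, Fin.prod_univ_def, Fin.sum_univ_def]

lemma integral_wave_sub (μ : Measure (Fin d → ℝ)) {p : (Fin d → ℝ) → ℝ} (hp : Integrable p μ)
    (ω : Fin d → ℝ) (θ : ℝ) :
    ((∫ x, p x * wave ω θ x ∂μ : ℝ) : ℂ) -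
        Complex.I * ((∫ x, p x * wave ω (θ - Real.pi / 2) x ∂μ : ℝ) : ℂ) =
      Complex.exp (((-θ : ℝ) : ℂ) * Complex.I) *
        ∫ x, Complex.exp (((-(2 * Real.pi * ∑ i, ω i * x i) : ℝ) : ℂ) * Complex.I) *
          (p x : ℂ) ∂μ := by
  have hw : ∀ θ, Integrable (fun x => p x * wave ω θ x) μ := fun θ =>
    hp.mul_bdd (c := 1) (contDiff_wave ω θ (n := 0)).continuous.aestronglyMeasurable
      (Eventually.of_forall fun x => Real.abs_cos_le_one _)
  rw [← integral_complex_ofReal, ← integral_complex_ofReal, ← integral_const_mul, ← integral_const_mul,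
    ← integral_sub]
  · refine integral_congr_ae (Eventually.of_forall fun x => ?_)
    simp only [wave]
    rw [← mul_assoc, ← Complex.exp_add, ← add_mul, ← Complex.ofReal_add, Complex.exp_mul_I,
      ← add_sub_assoc, Real.cos_sub_pi_div_two, ← neg_add, add_comm θ, ← Complex.ofReal_cos,
      ← Complex.ofReal_sin, Real.cos_neg, Real.sin_neg]
    push_cast
    ring
  · exact (hw θ).ofReal
  · exact ((hw _).ofReal).const_mul _

lemma isOpen_openCube : IsOpen (openCube d) :=
  isOpen_set_pi Set.finite_univ fun _ _ => isOpen_Ioo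

lemma openCube_subset_cube : openCube d ⊆ cube d := fun _ hx =>
  ⟨fun i => (hx i trivial).1.le, fun i => (hx i trivial).2.le⟩

lemma openCube_subset_halfOpenCube : openCube d ⊆ halfOpenCube d := fun _ hx i hi =>
  ⟨(hx i hi).1.le, (hx i hi).2⟩

lemma halfOpenCube_subset_cube : halfOpenCube d ⊆ cube d := fun _ hx =>
  ⟨fun i => (hx i trivial).1, fun i => (hx i trivial).2.le⟩

lemma isCompact_cube : IsCompact (cube d) := isCompact_Icc

lemma volume_openCube : volume (openCube d) = 1 := by
  simp [openCube, volume_pi_pi]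

instance : IsFiniteMeasure (volume.restrict (openCube d)) :=
  ⟨by rw [Measure.restrict_apply_univ, volume_openCube]; exact ENNReal.one_lt_top⟩

/-- A smooth cutoff function for a compact subset of the open cube. -/
lemma exists_cutoff {K : Set (Fin d → ℝ)} (hK : IsCompact K) (hKc : K ⊆ openCube d) :
    ∃ χ : (Fin d → ℝ) → ℝ, ContDiff ℝ (⊤ : ℕ∞) χ ∧ HasCompactSupport χ ∧
      tsupport χ ⊆ openCube d ∧ (∃ U, IsOpen U ∧ K ⊆ U ∧ ∀ x ∈ U, χ x = 1) ∧
      ∀ x, |χ x| ≤ 1 := by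
  obtain ⟨t, ht, hKt, htc⟩ := exists_compact_between hK isOpen_openCube hKc
  obtain ⟨f, hf1, hf0, hf⟩ := exists_contMDiffMap_one_nhds_of_subset_interior
    (modelWithCornersSelf ℝ (Fin d → ℝ)) (n := (⊤ : ℕ∞)) hK.isClosed hKt
  have hsupp : tsupport f ⊆ t := closure_minimal (fun x hx => by
    by_contra h
    exact hx (hf0 x h)) ht.isClosed
  obtain ⟨U, hU, hKU, hU1⟩ := mem_nhdsSet_iff_exists.1 hf1
  refine ⟨f, f.contMDiff.contDiff, ht.of_isClosed_subset (isClosed_tsupport _) hsupp,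
    hsupp.trans htc, ⟨U, hU, hKU, hU1⟩, fun x => abs_le.2 ⟨by linarith [(hf x).1], (hf x).2⟩⟩

/-- The Fourier transform of a compactly supported function with a weak derivative. -/
lemma norm_fourierInt_of_isWeakDeriv {f G χ : (Fin d → ℝ) → ℝ} {α : Fin d → ℕ}
    (hfc : ContinuousOn f (cube d)) (hG : MemLp G 2 (volume.restrict (openCube d)))
    (hw : IsWeakDeriv α f G) (hχ : ContDiff ℝ (⊤ : ℕ∞) χ) (hχc : HasCompactSupport χ)
    (hχs : tsupport χ ⊆ openCube d) {U : Set (Fin d → ℝ)} (hU : IsOpen U)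
    (hfU : ∀ x ∈ cube d, f x ≠ 0 → x ∈ U) (hχ1 : ∀ x ∈ U, χ x = 1) (hχb : ∀ x, |χ x| ≤ 1)
    (ω : Fin d → ℝ) :
    ‖fourierInt ((openCube d).indicator fun x => G x * χ x) ω‖ =
      (∏ i, |2 * Real.pi * ω i| ^ α i) * ‖fourierInt ((openCube d).indicator f) ω‖ := by
  set μ := volume.restrict (openCube d) with hμ
  set n := ∑ i, α i with hn
  set κ := ∏ i, (2 * Real.pi * ω i) ^ α i with hκ
  have hfi : Integrable f μ :=
    (hfc.integrableOn_compact isCompact_cube).mono_set openCube_subset_cube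
  have hGi : Integrable G μ := hG.integrable (by norm_num)
  have hGχ : Integrable (fun x => G x * χ x) μ :=
    hGi.mul_bdd (c := 1) hχ.continuous.aestronglyMeasurable (Eventually.of_forall hχb)
  have hFI : ∀ p : (Fin d → ℝ) → ℝ, fourierInt ((openCube d).indicator p) ω =
      ∫ x, Complex.exp (((-(2 * Real.pi * ∑ i, ω i * x i) : ℝ) : ℂ) * Complex.I) *
        (p x : ℂ) ∂μ := by
    intro p
    rw [fourierInt, hμ, ← integral_indicator isOpen_openCube.measurableSet]
    congr 1
    funext x
    by_cases hx : x ∈ openCube d <;> simp [hx]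
  have key : ∀ θ : ℝ, ∫ x, G x * χ x * wave ω θ x ∂μ =
      (-1) ^ n * (κ * ∫ x, f x * wave ω (θ + n * (Real.pi / 2)) x ∂μ) := by
    intro θ
    have h1 := hw.2.2 (fun x => χ x * wave ω θ x) (hχ.mul (contDiff_wave ω θ))
      hχc.mul_right ((tsupport_mul_subset_left).trans hχs)
    have h2 : ∫ x in openCube d, f x * mixedPartial α (fun x => χ x * wave ω θ x) x =
        κ * ∫ x, f x * wave ω (θ + n * (Real.pi / 2)) x ∂μ := by
      rw [← integral_const_mul]
      refine setIntegral_congr_fun isOpen_openCube.measurableSet fun x hx => ?_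
      by_cases hfx : f x = 0
      · simp [hfx]
      · have hxU := hfU x (openCube_subset_cube hx) hfx
        have h3 := mixedPartial_eqOn hU α (f := fun x => χ x * wave ω θ x) (g := wave ω θ)
          (fun y hy => by simp only [hχ1 y hy, one_mul]) hxU
        simp only [h3, mixedPartial_wave]
        ring
    rw [h2] at h1
    rw [h1, ← mul_assoc, ← mul_pow]
    simp [mul_assoc, hμ]
  have e1 := integral_wave_sub μ hGχ ω 0
  have e2 := integral_wave_sub μ hfi ω (n * (Real.pi / 2))
  rw [key 0, key (0 - Real.pi / 2), zero_add, zero_sub, neg_add_eq_sub] at e1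
  have e3 : ((((-1) ^ n * (κ * ∫ x, f x * wave ω (n * (Real.pi / 2)) x ∂μ) : ℝ) : ℂ) -
      Complex.I * (((-1) ^ n * (κ * ∫ x, f x * wave ω (n * (Real.pi / 2) - Real.pi / 2) x ∂μ) : ℝ)
        : ℂ)) = (((-1) ^ n * κ : ℝ) : ℂ) *
      (((∫ x, f x * wave ω (n * (Real.pi / 2)) x ∂μ : ℝ) : ℂ) -
        Complex.I * ((∫ x, f x * wave ω (n * (Real.pi / 2) - Real.pi / 2) x ∂μ : ℝ) : ℂ)) := by
    push_cast
    ring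
  rw [e3, e2, ← hFI, ← hFI] at e1
  have e4 := congr_arg norm e1
  rw [norm_mul, norm_mul, norm_mul, Complex.norm_exp_ofReal_mul_I, Complex.norm_exp_ofReal_mul_I,
    one_mul, one_mul, Complex.norm_real, norm_mul, norm_pow, norm_neg, norm_one, one_pow, one_mul,
    hκ, norm_prod] at e4
  simp only [norm_pow, Real.norm_eq_abs] at e4
  exact e4.symm

end WeakDerivative

section ErrorBound

variable {d s : ℕ}

lemma eLpNorm_le_mixNorm {α : Fin d → ℕ} (hα : α ∈ multiIndices d s)
    (F : (Fin d → ℕ) → (Fin d → ℝ) → ℝ) :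
    eLpNorm (F α) 2 (volume.restrict (openCube d)) ≤ mixNorm s F := by
  have h := Finset.single_le_sum
    (f := fun α => eLpNorm (F α) 2 (volume.restrict (openCube d)) ^ 2) (fun _ _ => zero_le) hα
  have h2 := ENNReal.rpow_le_rpow h (show (0 : ℝ) ≤ 1 / 2 by norm_num)
  refine le_trans (le_of_eq ?_) h2
  rw [← ENNReal.rpow_natCast, ← ENNReal.rpow_mul]
  norm_num

/-- Members of the closure of the unit ball have derivatives of norm at most two. -/
lemma integral_sq_le_of_approx {F : (Fin d → ℕ) → (Fin d → ℝ) → ℝ}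
    (hF : ∀ α ∈ multiIndices d s, MemLp (F α) 2 (volume.restrict (openCube d)))
    (happ : ∀ ε : ℝ≥0∞, 0 < ε → ∃ g ∈ smoothBall s d,
      mixNorm s (fun α x => F α x - mixedPartial α g x) < ε)
    {α : Fin d → ℕ} (hα : α ∈ multiIndices d s) :
    ∫ x in openCube d, F α x ^ 2 ≤ 4 := by
  obtain ⟨g, hg, hgF⟩ := happ 1 one_pos
  have h1 : eLpNorm (fun x => F α x - mixedPartial α g x) 2 (volume.restrict (openCube d)) ≤ 1 :=
    (eLpNorm_le_mixNorm hα (fun α x => F α x - mixedPartial α g x)).trans hgF.le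
  have h2 : eLpNorm (mixedPartial α g) 2 (volume.restrict (openCube d)) ≤ 1 :=
    (eLpNorm_le_mixNorm hα (fun α => mixedPartial α g)).trans hg.2
  have hgm : AEStronglyMeasurable g (volume.restrict (openCube d)) :=
    (hg.1.continuousOn.mono openCube_subset_cube).aestronglyMeasurable
      isOpen_openCube.measurableSet
  have hm := aestronglyMeasurable_mixedPartial α hgm
  have h3 : eLpNorm (F α) 2 (volume.restrict (openCube d)) ≤ 2 := by
    have h4 := eLpNorm_add_le (p := 2) ((hF α hα).aestronglyMeasurable.sub hm) hm (by norm_num)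
    rw [sub_add_cancel] at h4
    refine h4.trans ((add_le_add h1 h2).trans ?_)
    norm_num
  rw [(hF α hα).eLpNorm_eq_integral_rpow_norm (by norm_num) (by norm_num)] at h3
  have hnn : 0 ≤ ∫ x in openCube d, ‖F α x‖ ^ (2 : ℝ≥0∞).toReal :=
    integral_nonneg fun x => by positivity
  have h5 : (∫ x in openCube d, ‖F α x‖ ^ (2 : ℝ≥0∞).toReal) ^ ((2 : ℝ≥0∞).toReal)⁻¹ ≤ 2 := by
    have := ENNReal.toReal_mono (by norm_num) h3
    rwa [ENNReal.toReal_ofReal (by positivity)] at this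
  have h6 := Real.rpow_le_rpow (by positivity) h5 (show (0 : ℝ) ≤ 2 by norm_num)
  rw [← Real.rpow_mul hnn] at h6
  norm_num at h6
  exact h6

/-- The multi-index which is `s` on `t` and `0` elsewhere. -/
def subsetIndex (s : ℕ) (t : Finset (Fin d)) (i : Fin d) : ℕ := if i ∈ t then s else 0

lemma subsetIndex_mem (s : ℕ) (t : Finset (Fin d)) : subsetIndex s t ∈ multiIndices d s :=
  Fintype.mem_piFinset.2 fun i => Finset.mem_range.2 (by unfold subsetIndex; split_ifs <;> omega)

lemma sobolevWeight_eq_sum (s : ℕ) (ω : Fin d → ℝ) :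
    sobolevWeight s ω =
      ∑ t : Finset (Fin d), (∏ i, |2 * Real.pi * ω i| ^ subsetIndex s t i) ^ 2 := by
  rw [sobolevWeight, Finset.prod_one_add, Finset.powerset_univ]
  refine Finset.sum_congr rfl fun t _ => ?_
  rw [← Finset.prod_pow, ← Finset.prod_subset (Finset.subset_univ t)]
  · refine Finset.prod_congr rfl fun i hi => ?_
    rw [subsetIndex, if_pos hi, ← pow_mul, mul_comm 2 s]
  · intro i _ hi
    rw [subsetIndex, if_neg hi, pow_zero, one_pow]

/-- The function extended by zero outside the open cube. -/
def zeroExtend (f : (Fin d → ℝ) → ℝ) : (Fin d → ℝ) → ℝ := (openCube d).indicator f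

variable {f : (Fin d → ℝ) → ℝ}

lemma mem_openCube_of_ne_zero (hsupp : closure {x | x ∈ cube d ∧ f x ≠ 0} ⊆ openCube d)
    {x : Fin d → ℝ} (hx : x ∈ cube d) (hfx : f x ≠ 0) : x ∈ openCube d :=
  hsupp (subset_closure ⟨hx, hfx⟩)

lemma isCompact_support (hsupp : closure {x | x ∈ cube d ∧ f x ≠ 0} ⊆ openCube d) :
    IsCompact (closure {x | x ∈ cube d ∧ f x ≠ 0}) :=
  isCompact_cube.of_isClosed_subset isClosed_closure (hsupp.trans openCube_subset_cube)

lemma zeroExtend_support_subset : Function.support (zeroExtend f) ⊆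
    {x | x ∈ cube d ∧ f x ≠ 0} := by
  intro x hx
  have h1 : x ∈ openCube d := Set.mem_of_indicator_ne_zero hx
  exact ⟨openCube_subset_cube h1, by
    rwa [Function.mem_support, zeroExtend, Set.indicator_of_mem h1] at hx⟩

lemma continuous_zeroExtend (hfc : ContinuousOn f (cube d))
    (hsupp : closure {x | x ∈ cube d ∧ f x ≠ 0} ⊆ openCube d) : Continuous (zeroExtend f) := by
  refine continuous_iff_continuousAt.2 fun x => ?_
  by_cases hx : x ∈ openCube d
  · have h1 : ContinuousAt f x :=
      (hfc.mono openCube_subset_cube).continuousAt (isOpen_openCube.mem_nhds hx)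
    refine h1.congr ?_
    filter_upwards [isOpen_openCube.mem_nhds hx] with y hy
    rw [zeroExtend, Set.indicator_of_mem hy]
  · have h1 : x ∈ (closure {x | x ∈ cube d ∧ f x ≠ 0})ᶜ := fun h => hx (hsupp h)
    have h2 : (fun _ => (0 : ℝ)) =ᶠ[𝓝 x] zeroExtend f := by
      filter_upwards [isClosed_closure.isOpen_compl.mem_nhds h1] with y hy
      by_contra hne
      exact hy (subset_closure (zeroExtend_support_subset (Ne.symm hne)))
    exact continuousAt_const.congr h2

lemma hasCompactSupport_zeroExtend
    (hsupp : closure {x | x ∈ cube d ∧ f x ≠ 0} ⊆ openCube d) :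
    HasCompactSupport (zeroExtend f) :=
  (isCompact_support hsupp).of_isClosed_subset (isClosed_tsupport _)
    (closure_mono zeroExtend_support_subset)

lemma fourierInt_zeroExtend_zero (hsupp : closure {x | x ∈ cube d ∧ f x ≠ 0} ⊆ openCube d) :
    fourierInt (zeroExtend f) 0 = ((∫ x in cube d, f x : ℝ) : ℂ) := by
  have h : ∫ x in cube d, f x = ∫ x, zeroExtend f x := by
    rw [zeroExtend, integral_indicator isOpen_openCube.measurableSet]
    refine setIntegral_eq_of_subset_of_forall_sdiff_eq_zero isCompact_cube.measurableSet
      openCube_subset_cube fun x hx => ?_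
    by_contra hne
    exact hx.2 (mem_openCube_of_ne_zero hsupp hx.1 hne)
  rw [h, fourierInt, ← integral_complex_ofReal]
  simp

/-- Bessel's inequality for all derivatives of a function in the class. -/
lemma sum_sobolevWeight_mul_le (hf : f ∈ mixClassZero s d) {M : Matrix (Fin d) (Fin d) ℝ}
    (hM : M.det ≠ 0) {N : ℕ} (hN : ∀ x ∈ cube d, ∀ i, |M.mulVec x i| ≤ N)
    (S : Finset (Fin d → ℤ)) :
    ∑ m ∈ S, sobolevWeight s (M.transpose.mulVec fun i => (m i : ℝ)) *
      ‖fourierInt (zeroExtend f) (M.transpose.mulVec fun i => (m i : ℝ))‖ ^ 2 ≤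
      2 ^ d * ((2 * N + 2) ^ d / |M.det| * 4) := by
  obtain ⟨⟨hfc, F, hF, happ⟩, hsupp⟩ := hf
  obtain ⟨χ, hχ, hχc, hχs, ⟨U, hU, hKU, hχ1⟩, hχb⟩ :=
    exists_cutoff (isCompact_support hsupp) hsupp
  have hpiece : ∀ t : Finset (Fin d),
      ∑ m ∈ S, (∏ i, |2 * Real.pi * (M.transpose.mulVec fun i => (m i : ℝ)) i| ^
        subsetIndex s t i) ^ 2 *
        ‖fourierInt (zeroExtend f) (M.transpose.mulVec fun i => (m i : ℝ))‖ ^ 2 ≤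
      (2 * N + 2) ^ d / |M.det| * 4 := by
    intro t
    set α := subsetIndex s t
    have hα : α ∈ multiIndices d s := subsetIndex_mem s t
    have hG := (hF α hα).1
    have hGχ : MemLp (fun x => F α x * χ x) 2 (volume.restrict (openCube d)) := by
      refine hG.of_le (hG.aestronglyMeasurable.mul hχ.continuous.aestronglyMeasurable)
        (Eventually.of_forall fun x => ?_)
      rw [norm_mul]
      exact mul_le_of_le_one_right (norm_nonneg _) (hχb x)
    have hind : MemLp ((openCube d).indicator fun x => F α x * χ x) 2 :=
      (memLp_indicator_iff_restrict isOpen_openCube.measurableSet).2 hGχ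
    have hindi : Integrable ((openCube d).indicator fun x => F α x * χ x) :=
      (integrable_indicator_iff isOpen_openCube.measurableSet).2 (hGχ.integrable (by norm_num))
    have hB := sum_norm_sq_fourierInt_le hM hindi hind
      (fun x hx => openCube_subset_cube (Set.mem_of_indicator_ne_zero hx)) hN S
    have hle : ∫ x, ((openCube d).indicator (fun x => F α x * χ x) x) ^ 2 ≤ 4 := by
      have e : ∀ x, ((openCube d).indicator (fun x => F α x * χ x) x) ^ 2 =
          (openCube d).indicator (fun x => (F α x * χ x) ^ 2) x := fun x => by
        by_cases hx : x ∈ openCube d <;> simp [hx]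
      simp only [e]
      rw [integral_indicator isOpen_openCube.measurableSet]
      refine (integral_mono_of_nonneg (Eventually.of_forall fun x => sq_nonneg _)
        hG.integrable_sq (Eventually.of_forall fun x => ?_)).trans
        (integral_sq_le_of_approx (fun α hα => (hF α hα).1) happ hα)
      simp only [mul_pow]
      refine mul_le_of_le_one_right (sq_nonneg _) ?_
      rw [← sq_abs]
      exact pow_le_one₀ (abs_nonneg _) (hχb x)
    refine le_trans (le_of_eq ?_) (hB.trans
      (mul_le_mul_of_nonneg_left hle (by positivity)))
    refine Finset.sum_congr rfl fun m _ => ?_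
    rw [norm_fourierInt_of_isWeakDeriv hfc hG (hF α hα).2 hχ hχc hχs hU
      (fun x hx hfx => hKU (subset_closure ⟨hx, hfx⟩)) hχ1 hχb, mul_pow]
    rfl
  simp only [sobolevWeight_eq_sum, Finset.sum_mul]
  rw [Finset.sum_comm]
  refine (Finset.sum_le_card_nsmul _ _ _ fun t _ => hpiece t).trans (le_of_eq ?_)
  rw [nsmul_eq_mul, Finset.card_univ, Fintype.card_finset, Fintype.card_fin]
  push_cast
  rfl

variable {ξ : Fin d → ℝ}

/-- The scaled transposed Vandermonde matrix `a Bᵀ`, the inverse of `a⁻¹ T`. -/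
def scaledMatrix (ξ : Fin d → ℝ) (a : ℝ) : Matrix (Fin d) (Fin d) ℝ :=
  a • (Matrix.vandermonde ξ).transpose

lemma IsRootEnumeration.det_ne_zero (h : IsRootEnumeration d ξ) :
    (Matrix.vandermonde ξ).det ≠ 0 :=
  Matrix.det_vandermonde_ne_zero_iff.2 h.1

lemma det_scaledMatrix (ξ : Fin d → ℝ) (a : ℝ) :
    (scaledMatrix ξ a).det = a ^ d * (Matrix.vandermonde ξ).det := by
  rw [scaledMatrix, Matrix.det_smul, Matrix.det_transpose, Fintype.card_fin]

lemma IsRootEnumeration.det_scaledMatrix_ne_zero (h : IsRootEnumeration d ξ) {a : ℝ} (ha : 0 < a) :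
    (scaledMatrix ξ a).det ≠ 0 := by
  rw [det_scaledMatrix]
  exact mul_ne_zero (pow_pos ha d).ne' h.det_ne_zero

lemma inv_scaledMatrix_mulVec (h : IsRootEnumeration d ξ) {a : ℝ} (ha : 0 < a) (y : Fin d → ℝ) :
    (scaledMatrix ξ a)⁻¹.mulVec y = a⁻¹ • (generator ξ).mulVec y := by
  have hdet : (Matrix.vandermonde ξ).transpose.det ≠ 0 := by
    rw [Matrix.det_transpose]
    exact h.det_ne_zero
  have h1 : (scaledMatrix ξ a).mulVec (a⁻¹ • (generator ξ).mulVec y) = y := by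
    rw [scaledMatrix, generator, Matrix.smul_mulVec, Matrix.mulVec_smul, smul_smul,
      mul_inv_cancel₀ ha.ne', one_smul, mulVec_inv_mulVec hdet]
  conv_lhs => rw [← h1]
  rw [inv_mulVec_mulVec (h.det_scaledMatrix_ne_zero ha)]

lemma scaledMatrix_transpose_mulVec (ξ : Fin d → ℝ) (a : ℝ) (y : Fin d → ℝ) :
    (scaledMatrix ξ a).transpose.mulVec y = fun i => a * (Matrix.vandermonde ξ).mulVec y i := by
  rw [scaledMatrix, Matrix.transpose_smul, Matrix.transpose_transpose, Matrix.smul_mulVec]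
  rfl

/-- The map `z ↦ B z` as an additive homomorphism. -/
def latticeHom (ξ : Fin d → ℝ) : (Fin d → ℤ) →+ (Fin d → ℝ) where
  toFun z := (Matrix.vandermonde ξ).mulVec fun i => (z i : ℝ)
  map_zero' := by
    convert Matrix.mulVec_zero (Matrix.vandermonde ξ)
    simp
  map_add' z w := by
    rw [← Matrix.mulVec_add]
    congr 1
    funext i
    simp

/-- A bound for the entries of `Bᵀ x`, `x` in the unit cube. -/
def entryBound (ξ : Fin d → ℝ) : ℝ := ∑ i, ∑ j, |(Matrix.vandermonde ξ) i j|

lemma entryBound_nonneg (ξ : Fin d → ℝ) : 0 ≤ entryBound ξ :=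
  Finset.sum_nonneg fun _ _ => Finset.sum_nonneg fun _ _ => abs_nonneg _

lemma abs_scaledMatrix_mulVec_le {a : ℝ} (ha : 0 < a) {x : Fin d → ℝ} (hx : x ∈ cube d)
    (i : Fin d) : |(scaledMatrix ξ a).mulVec x i| ≤ (⌈a * entryBound ξ⌉₊ : ℝ) := by
  refine le_trans ?_ (Nat.le_ceil _)
  rw [scaledMatrix, Matrix.smul_mulVec, Pi.smul_apply, smul_eq_mul, abs_mul, abs_of_pos ha]
  refine mul_le_mul_of_nonneg_left ?_ ha.le
  rw [Matrix.mulVec, dotProduct]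
  refine (Finset.abs_sum_le_sum_abs _ _).trans (Finset.sum_le_sum fun j _ => ?_)
  rw [abs_mul, Matrix.transpose_apply]
  have h1 : |x j| ≤ 1 := abs_le.2 ⟨by linarith [hx.1 j, show (0 : Fin d → ℝ) j = 0 from rfl],
    hx.2 j⟩
  refine (mul_le_of_le_one_right (abs_nonneg _) h1).trans ?_
  exact Finset.single_le_sum (f := fun i => |Matrix.vandermonde ξ j i|)
    (fun _ _ => abs_nonneg _) (Finset.mem_univ i)

/-- The constant `D` such that a Frolov rule has at most `(D a)^d` nodes. -/
def nodeBound (ξ : Fin d → ℝ) : ℝ := 2 * entryBound ξ + 4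

lemma nodeBound_ge (ξ : Fin d → ℝ) : 1 ≤ nodeBound ξ := by
  have := entryBound_nonneg ξ
  unfold nodeBound
  linarith

lemma two_mul_ceil_add_two_le {a : ℝ} (ha : 1 ≤ a) :
    2 * (⌈a * entryBound ξ⌉₊ : ℝ) + 2 ≤ nodeBound ξ * a := by
  have h0 := entryBound_nonneg ξ
  have := Nat.ceil_lt_add_one (mul_nonneg (zero_le_one.trans ha) h0)
  unfold nodeBound
  nlinarith

/-- The Frolov rule as a sum over the whole lattice. -/
lemma frolovRule_eq_finsum (h : IsRootEnumeration d ξ) {a : ℝ} (ha : 0 < a)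
    (hsupp : closure {x | x ∈ cube d ∧ f x ≠ 0} ⊆ openCube d) :
    frolovRule ξ a f = |(scaledMatrix ξ a).det|⁻¹ *
      ∑ᶠ k : Fin d → ℤ, zeroExtend f ((scaledMatrix ξ a)⁻¹.mulVec fun i => (k i : ℝ)) := by
  have hdet : |(scaledMatrix ξ a).det|⁻¹ = (a ^ d)⁻¹ * |(generator ξ).det| := by
    rw [det_scaledMatrix, generator, Matrix.det_nonsing_inv, Matrix.det_transpose,
      Ring.inverse_eq_inv', abs_mul, abs_inv, mul_inv, abs_of_pos (pow_pos ha d)]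
  have hinj : Function.Injective fun k : Fin d → ℤ =>
      (scaledMatrix ξ a)⁻¹.mulVec fun i => (k i : ℝ) := by
    intro k l hkl
    have h1 := congr_arg (scaledMatrix ξ a).mulVec hkl
    simp only [mulVec_inv_mulVec (h.det_scaledMatrix_ne_zero ha)] at h1
    funext i
    exact_mod_cast congr_fun h1 i
  rw [frolovRule, hdet, ← finsum_mem_range (f := zeroExtend f) hinj]
  congr 1
  have hnodes : frolovNodes ξ a =
      Set.range (fun k : Fin d → ℤ => (scaledMatrix ξ a)⁻¹.mulVec fun i => (k i : ℝ)) ∩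
        halfOpenCube d := by
    ext x
    simp only [frolovNodes, inv_scaledMatrix_mulVec h ha, Set.mem_inter_iff, Set.mem_range,
      Set.mem_ofPred_eq, eq_comm]
  rw [hnodes, finsum_mem_def, finsum_mem_def]
  refine finsum_congr fun x => ?_
  by_cases hxr : x ∈ Set.range
      (fun k : Fin d → ℤ => (scaledMatrix ξ a)⁻¹.mulVec fun i => (k i : ℝ))
  · rw [Set.indicator_of_mem hxr]
    by_cases hxo : x ∈ openCube d
    · rw [Set.indicator_of_mem (Set.mem_inter hxr (openCube_subset_halfOpenCube hxo)), zeroExtend,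
        Set.indicator_of_mem hxo]
    · rw [zeroExtend, Set.indicator_of_notMem hxo]
      by_cases hxh : x ∈ halfOpenCube d
      · rw [Set.indicator_of_mem (Set.mem_inter hxr hxh)]
        by_contra hne
        exact hxo (mem_openCube_of_ne_zero hsupp (halfOpenCube_subset_cube hxh) hne)
      · rw [Set.indicator_of_notMem fun h => hxh h.2]
  · rw [Set.indicator_of_notMem hxr, Set.indicator_of_notMem fun h => hxr h.1]

/-- The constant in Bessel's inequality for the scaled Frolov lattice. -/
def besselConst (ξ : Fin d → ℝ) : ℝ :=
  2 ^ d * (nodeBound ξ ^ d / |(Matrix.vandermonde ξ).det| * 4)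

lemma IsRootEnumeration.besselConst_pos (h : IsRootEnumeration d ξ) : 0 < besselConst ξ := by
  have := abs_pos.2 h.det_ne_zero
  have := nodeBound_ge ξ
  unfold besselConst
  positivity

lemma sum_scaled_sobolevWeight_mul_le (h : IsRootEnumeration d ξ) (hf : f ∈ mixClassZero s d)
    {a : ℝ} (ha : 1 ≤ a) (S : Finset (Fin d → ℤ)) :
    ∑ m ∈ S, sobolevWeight s (fun i => a * latticeHom ξ m i) *
      ‖fourierInt (zeroExtend f) (fun i => a * latticeHom ξ m i)‖ ^ 2 ≤ besselConst ξ := by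
  have ha0 : 0 < a := by linarith
  have hB := sum_sobolevWeight_mul_le hf (h.det_scaledMatrix_ne_zero ha0)
    (fun x hx i => abs_scaledMatrix_mulVec_le ha0 hx i) S
  simp only [scaledMatrix_transpose_mulVec] at hB
  refine hB.trans ?_
  have hdet := abs_pos.2 h.det_ne_zero
  rw [besselConst, det_scaledMatrix, abs_mul, abs_of_pos (pow_pos ha0 d)]
  have h1 : (2 * (⌈a * entryBound ξ⌉₊ : ℝ) + 2) ^ d ≤ nodeBound ξ ^ d * a ^ d := by
    rw [← mul_pow]
    exact pow_le_pow_left₀ (by positivity) (two_mul_ceil_add_two_le ha) d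
  have h2 : (2 * (⌈a * entryBound ξ⌉₊ : ℝ) + 2) ^ d / (a ^ d * |(Matrix.vandermonde ξ).det|) ≤
      nodeBound ξ ^ d / |(Matrix.vandermonde ξ).det| := by
    rw [div_le_div_iff₀ (by positivity) hdet]
    nlinarith
  gcongr

/-- The error of the Frolov rule in terms of the scaling parameter. -/
lemma frolovRule_error (hs : 1 ≤ s) (hd : 1 ≤ d) (h : IsRootEnumeration d ξ) :
    ∃ C : ℝ, 0 < C ∧ ∀ a : ℝ, 1 ≤ a → ∀ f ∈ mixClassZero s d,
      |(∫ x in cube d, f x) - frolovRule ξ a f| ≤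
        C * ((a ^ (s * d))⁻¹ * (1 + Real.log a) ^ (((d : ℝ) - 1) / 2)) := by
  obtain ⟨C₀, hC₀, hcount⟩ := sum_inv_sobolevWeight_le (s := s) (d := d) hs hd
  have hbes := h.besselConst_pos
  refine ⟨√(C₀ * besselConst ξ), by positivity, fun a ha f hf => ?_⟩
  have ha0 : 0 < a := by linarith
  have hlog : 0 ≤ Real.log a := Real.log_nonneg ha
  have hfc := hf.1.1
  have hsupp := hf.2
  set E : ℝ := √(C₀ * besselConst ξ) *
    ((a ^ (s * d))⁻¹ * (1 + Real.log a) ^ (((d : ℝ) - 1) / 2)) with hE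
  have hE2 : C₀ * ((a ^ (s * d))⁻¹) ^ 2 * (1 + Real.log a) ^ (d - 1) * besselConst ξ = E ^ 2 := by
    rw [hE, mul_pow, mul_pow, Real.sq_sqrt (by positivity), ← Real.rpow_natCast _ 2,
      ← Real.rpow_natCast _ 2, ← Real.rpow_mul (by positivity), Nat.cast_ofNat,
      div_mul_cancel₀ _ (two_ne_zero), ← Real.rpow_natCast _ (d - 1), Nat.cast_sub hd]
    norm_num
    ring
  have hE0 : 0 ≤ E := by positivity
  set ω : (Fin d → ℤ) → (Fin d → ℝ) := fun m i => a * latticeHom ξ m i with hω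
  set F : (Fin d → ℤ) → ℂ := fun m => fourierInt (zeroExtend f) (ω m) with hF
  have hfin : ∀ S : Finset (Fin d → ℤ), 0 ∉ S → ∑ m ∈ S, ‖F m‖ ≤ E := by
    intro S hS
    have hc := hcount (latticeHom ξ) (fun z hz => h.one_le_prod hd hz) a ha S hS
    have hb := sum_scaled_sobolevWeight_mul_le h hf ha S
    refine abs_le_of_sq_le_sq' ?_ hE0 |>.2
    calc (∑ m ∈ S, ‖F m‖) ^ 2
        = (∑ m ∈ S, √((sobolevWeight s (ω m))⁻¹) * (√(sobolevWeight s (ω m)) * ‖F m‖)) ^ 2 := by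
          congr 1
          refine Finset.sum_congr rfl fun m _ => ?_
          have := sobolevWeight_pos s (ω m)
          rw [← mul_assoc, ← Real.sqrt_mul (by positivity), inv_mul_cancel₀ this.ne',
            Real.sqrt_one, one_mul]
      _ ≤ (∑ m ∈ S, √((sobolevWeight s (ω m))⁻¹) ^ 2) *
            ∑ m ∈ S, (√(sobolevWeight s (ω m)) * ‖F m‖) ^ 2 :=
          Finset.sum_mul_sq_le_sq_mul_sq _ _ _
      _ = (∑ m ∈ S, (sobolevWeight s (ω m))⁻¹) *
            ∑ m ∈ S, sobolevWeight s (ω m) * ‖F m‖ ^ 2 := by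
          congr 1
          · exact Finset.sum_congr rfl fun m _ =>
              Real.sq_sqrt (inv_nonneg.2 (sobolevWeight_pos s (ω m)).le)
          · exact Finset.sum_congr rfl fun m _ => by
              rw [mul_pow, Real.sq_sqrt (sobolevWeight_pos s (ω m)).le]
      _ ≤ (C₀ * ((a ^ (s * d))⁻¹) ^ 2 * (1 + Real.log a) ^ (d - 1)) * besselConst ξ :=
          mul_le_mul hc hb (Finset.sum_nonneg fun m _ =>
            mul_nonneg (sobolevWeight_pos s (ω m)).le (sq_nonneg _)) (by positivity)
      _ = E ^ 2 := hE2
  have hsum : Summable F := by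
    refine Summable.of_norm (summable_of_sum_le (c := E + ‖F 0‖) (fun _ => norm_nonneg _) fun S => ?_)
    refine (Finset.sum_le_sum_of_subset_of_nonneg (Finset.subset_union_left (s₂ := {0}))
      fun _ _ _ => norm_nonneg _).trans ?_
    rw [← Finset.sum_erase_add _ _ (show (0 : Fin d → ℤ) ∈ S ∪ {0} by simp)]
    gcongr
    exact hfin _ (by simp)
  have hcs := hasCompactSupport_zeroExtend hsupp
  have hcont := continuous_zeroExtend hfc hsupp
  have hP := hasSum_fourierInt (h.det_scaledMatrix_ne_zero ha0) hcont
    (hcont.integrable_of_hasCompactSupport hcs) (hcont.memLp_of_hasCompactSupport hcs)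
    (fun x hx => (zeroExtend_support_subset hx).1)
    (fun x hx i => abs_scaledMatrix_mulVec_le ha0 hx i)
    (by simpa only [scaledMatrix_transpose_mulVec] using! hsum)
  rw [← frolovRule_eq_finsum h ha0 hsupp] at hP
  simp only [scaledMatrix_transpose_mulVec] at hP
  have hP' : HasSum F (frolovRule ξ a f : ℂ) := hP
  have hF0 : F 0 = ((∫ x in cube d, f x : ℝ) : ℂ) := by
    rw [← fourierInt_zeroExtend_zero hsupp, hF]
    simp only [hω, map_zero, Pi.zero_apply, mul_zero]
    rfl
  have hlim : Tendsto (fun S : Finset (Fin d → ℤ) => ‖∑ m ∈ S, F m - F 0‖) atTop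
      (𝓝 ‖(frolovRule ξ a f : ℂ) - F 0‖) := (Tendsto.sub_const hP' _).norm
  have hle : ‖(frolovRule ξ a f : ℂ) - F 0‖ ≤ E := by
    refine le_of_tendsto hlim ?_
    filter_upwards [eventually_ge_atTop ({0} : Finset (Fin d → ℤ))] with S hS
    have h0S : (0 : Fin d → ℤ) ∈ S := hS (Finset.mem_singleton_self _)
    rw [← Finset.sum_erase_add _ _ h0S, add_sub_cancel_right]
    exact (norm_sum_le _ _).trans (hfin _ (by simp))
  rw [hF0, ← Complex.ofReal_sub, Complex.norm_real, Real.norm_eq_abs, abs_sub_comm] at hle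
  exact hle

lemma abs_integral_le (h : IsRootEnumeration d ξ) (hf : f ∈ mixClassZero s d) :
    |∫ x in cube d, f x| ≤ √(besselConst ξ) := by
  have hb := sum_scaled_sobolevWeight_mul_le h hf le_rfl {0}
  rw [Finset.sum_singleton] at hb
  have e : (fun i => 1 * latticeHom ξ 0 i) = 0 := by
    funext i
    simp
  rw [e, fourierInt_zeroExtend_zero hf.2, Complex.norm_real, Real.norm_eq_abs, sq_abs] at hb
  refine Real.abs_le_sqrt (le_trans ?_ hb)
  refine le_mul_of_one_le_left (sq_nonneg _) (Finset.one_le_prod fun i _ => ?_)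
  have : 0 ≤ |2 * Real.pi * (0 : Fin d → ℝ) i| ^ (2 * s) := by positivity
  linarith

end ErrorBound

section Nodes

variable {d s : ℕ} {ξ : Fin d → ℝ}

lemma IsRootEnumeration.exists_int_ones (hd : 1 ≤ d) (h : IsRootEnumeration d ξ) :
    ∃ z : Fin d → ℤ, (Matrix.vandermonde ξ).transpose.mulVec 1 = fun i => (z i : ℝ) := by
  choose z hz using fun k : Fin d => h.sum_pow_int hd k
  refine ⟨z, funext fun i => ?_⟩
  rw [← hz]
  simp [Matrix.mulVec, dotProduct, Matrix.vandermonde_apply]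

lemma mem_frolovNodes_iff (h : IsRootEnumeration d ξ) {a : ℝ} (ha : 0 < a) {x : Fin d → ℝ} :
    x ∈ frolovNodes ξ a ↔
      (∃ z : Fin d → ℤ, (scaledMatrix ξ a).mulVec x = fun i => (z i : ℝ)) ∧
        x ∈ halfOpenCube d := by
  refine and_congr_left fun _ => exists_congr fun z => ?_
  rw [← inv_scaledMatrix_mulVec h ha]
  constructor
  · rintro rfl
    exact mulVec_inv_mulVec (h.det_scaledMatrix_ne_zero ha) _
  · intro hz
    rw [← hz, inv_mulVec_mulVec (h.det_scaledMatrix_ne_zero ha)]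

/-- The diagonal points `(k/a)(1,…,1)` are nodes. -/
lemma diagonal_mem_frolovNodes (hd : 1 ≤ d) (h : IsRootEnumeration d ξ) {a : ℝ} (ha : 0 < a)
    {k : ℕ} (hk : (k : ℝ) < a) : (fun _ => (k : ℝ) / a) ∈ frolovNodes ξ a := by
  obtain ⟨z, hz⟩ := h.exists_int_ones hd
  refine (mem_frolovNodes_iff h ha).2 ⟨⟨fun i => k * z i, ?_⟩, fun i _ =>
    ⟨by positivity, (div_lt_one ha).2 hk⟩⟩
  have e : (fun _ : Fin d => (k : ℝ) / a) = (k / a : ℝ) • (1 : Fin d → ℝ) := by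
    funext i
    simp
  rw [e, Matrix.mulVec_smul, scaledMatrix, Matrix.smul_mulVec, hz, smul_smul,
    div_mul_cancel₀ _ ha.ne']
  funext i
  simp

lemma frolovNodes_finite_and_card (h : IsRootEnumeration d ξ) {a : ℝ} (ha : 1 ≤ a) :
    (frolovNodes ξ a).Finite ∧ ((frolovNodes ξ a).ncard : ℝ) ≤ (nodeBound ξ * a) ^ d := by
  have ha0 : 0 < a := by linarith
  set N := ⌈a * entryBound ξ⌉₊ with hN
  set Z : Finset (Fin d → ℤ) := Fintype.piFinset fun _ => Finset.Icc (-(N : ℤ)) N with hZ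
  have hsub : frolovNodes ξ a ⊆
      (fun z : Fin d → ℤ => (scaledMatrix ξ a)⁻¹.mulVec fun i => (z i : ℝ)) '' (Z : Set _) := by
    intro x hx
    obtain ⟨⟨z, hz⟩, hxc⟩ := (mem_frolovNodes_iff h ha0).1 hx
    refine ⟨z, Fintype.mem_piFinset.2 fun i => Finset.mem_Icc.2 ?_, ?_⟩
    · have h1 := abs_scaledMatrix_mulVec_le (ξ := ξ) ha0 (halfOpenCube_subset_cube hxc) i
      rw [hz] at h1
      have h2 := abs_le.1 h1
      simp only [← hN] at h2
      exact ⟨by exact_mod_cast h2.1, by exact_mod_cast h2.2⟩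
    · simp only [← hz, inv_mulVec_mulVec (h.det_scaledMatrix_ne_zero ha0)]
  have hfin := (Z.finite_toSet.image
    (fun z : Fin d → ℤ => (scaledMatrix ξ a)⁻¹.mulVec fun i => (z i : ℝ)))
  refine ⟨hfin.subset hsub, ?_⟩
  have h1 : (frolovNodes ξ a).ncard ≤ Z.card := by
    refine (Set.ncard_le_ncard hsub hfin).trans ((Set.ncard_image_le Z.finite_toSet).trans ?_)
    rw [Set.ncard_coe_finset]
  have h2 : Z.card = (2 * N + 1) ^ d := by
    simp only [hZ, Fintype.card_piFinset, Int.card_Icc, Finset.prod_const, Finset.card_univ,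
      Fintype.card_fin]
    congr 1
    omega
  calc ((frolovNodes ξ a).ncard : ℝ) ≤ (2 * N + 1 : ℝ) ^ d := by
        rw [h2] at h1
        exact_mod_cast h1
    _ ≤ _ := by
        have := two_mul_ceil_add_two_le (ξ := ξ) ha
        exact pow_le_pow_left₀ (by positivity) (by linarith) d

lemma ceil_le_ncard_frolovNodes (hd : 1 ≤ d) (h : IsRootEnumeration d ξ) {a : ℝ} (ha : 1 ≤ a) :
    ⌈a⌉₊ ≤ (frolovNodes ξ a).ncard := by
  have ha0 : 0 < a := by linarith
  set g : ℕ → Fin d → ℝ := fun k _ => (k : ℝ) / a with hg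
  have hinj : Function.Injective g := by
    intro k l hkl
    have := congr_fun hkl ⟨0, hd⟩
    simp only [hg, div_left_inj' ha0.ne'] at this
    exact_mod_cast this
  have hsub : ((Finset.range ⌈a⌉₊).image g : Set (Fin d → ℝ)) ⊆ frolovNodes ξ a := by
    intro x hx
    obtain ⟨k, hk, rfl⟩ := Finset.mem_image.1 (Finset.mem_coe.1 hx)
    exact diagonal_mem_frolovNodes hd h ha0 (Nat.lt_ceil.1 (Finset.mem_range.1 hk))
  have h1 := Set.ncard_le_ncard hsub (frolovNodes_finite_and_card h ha).1
  rwa [Set.ncard_coe_finset, Finset.card_image_of_injective _ hinj, Finset.card_range] at h1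

/-- Comparison of the error in terms of `a` with the rate in terms of the number of nodes. -/
lemma scaled_bound_le_rate (hd : 1 ≤ d) {a D : ℝ} (ha : 1 ≤ a) (hD : 1 ≤ D) {n : ℕ} (hn : 2 ≤ n)
    (han : a ≤ n) (hna : (n : ℝ) ≤ (D * a) ^ d) :
    (a ^ (s * d))⁻¹ * (1 + Real.log a) ^ (((d : ℝ) - 1) / 2) ≤
      (D ^ (d * s) * 3 ^ (((d : ℝ) - 1) / 2)) * rate s d n := by
  have ha0 : 0 < a := by linarith
  have hn0 : (2 : ℝ) ≤ n := by exact_mod_cast hn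
  have hp : 0 ≤ ((d : ℝ) - 1) / 2 := by
    have : (1 : ℝ) ≤ d := by exact_mod_cast hd
    linarith
  have h1 : (a ^ (s * d))⁻¹ ≤ D ^ (d * s) * ((n : ℝ) ^ s)⁻¹ := by
    have h2 : (n : ℝ) ^ s ≤ D ^ (d * s) * a ^ (s * d) := by
      refine (pow_le_pow_left₀ (by positivity) hna s).trans (le_of_eq ?_)
      rw [mul_pow, mul_pow, ← pow_mul, ← pow_mul, mul_comm s d]
    rw [← div_eq_mul_inv, le_div_iff₀ (by positivity), mul_comm, ← div_eq_mul_inv,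
      div_le_iff₀ (by positivity)]
    exact h2
  have h3 : 1 + Real.log a ≤ 3 * Real.log n := by
    have h4 := Real.log_le_log ha0 han
    have h5 := Real.log_le_log (by norm_num) hn0
    have := Real.log_two_gt_d9
    linarith
  have h0 := Real.log_nonneg ha
  have h6 : (1 + Real.log a) ^ (((d : ℝ) - 1) / 2) ≤
      3 ^ (((d : ℝ) - 1) / 2) * Real.log n ^ (((d : ℝ) - 1) / 2) := by
    rw [← Real.mul_rpow (by norm_num) (Real.log_nonneg (by linarith))]
    exact Real.rpow_le_rpow (by positivity) h3 hp
  calc _ ≤ (D ^ (d * s) * ((n : ℝ) ^ s)⁻¹) *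
        (3 ^ (((d : ℝ) - 1) / 2) * Real.log n ^ (((d : ℝ) - 1) / 2)) := by
        gcongr
    _ = _ := by rw [rate]; ring

lemma rate_nonneg (s d : ℕ) {n : ℕ} (hn : 2 ≤ n) : 0 ≤ rate s d n := by
  have : 0 ≤ Real.log n := Real.log_nonneg (by exact_mod_cast (by omega : 1 ≤ n))
  unfold rate
  positivity

/-- An equal-weight sum over at most `n` points of the cube is a cubature rule. -/
lemma exists_cubatureRule {n : ℕ} (X : Finset (Fin d → ℝ)) (hX : ∀ x ∈ X, x ∈ cube d)
    (hcard : X.card ≤ n) (w : ℝ) :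
    ∃ Q : CubatureRule d n, ∀ f : (Fin d → ℝ) → ℝ, Q.eval f = w * ∑ x ∈ X, f x := by
  obtain ⟨e⟩ := Function.Embedding.nonempty_of_card_le (α := X) (β := Fin n) (by simpa using hcard)
  have hmem : ∀ j, Function.extend e (fun x => x.1) 0 j ∈ cube d := by
    intro j
    by_cases hj : ∃ x, e x = j
    · obtain ⟨x, rfl⟩ := hj
      rw [e.injective.extend_apply]
      exact hX _ x.2
    · rw [Function.extend_apply' _ _ _ hj]
      exact Set.left_mem_Icc.2 zero_le_one
  refine ⟨⟨Function.extend e (fun x => x.1) 0, hmem, Function.extend e (fun _ => w) 0⟩,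
    fun f => ?_⟩
  rw [CubatureRule.eval, Finset.mul_sum, ← Finset.sum_coe_sort X (fun x => w * f x)]
  refine (Fintype.sum_of_injective e e.injective _ _ (fun j hj => ?_) fun x => ?_).symm
  · dsimp only
    rw [Function.extend_apply' (fun _ => w) _ _ (fun h => hj h), Pi.zero_apply, zero_mul]
  · dsimp only
    rw [e.injective.extend_apply, e.injective.extend_apply]

lemma worstCaseError_le {Q : ((Fin d → ℝ) → ℝ) → ℝ} {H : Set ((Fin d → ℝ) → ℝ)} {b : ℝ}
    (h : ∀ f ∈ H, |(∫ x in cube d, f x) - Q f| ≤ b) :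
    worstCaseError Q H ≤ ENNReal.ofReal b :=
  iSup₂_le fun f hf => ENNReal.ofReal_le_ofReal (h f hf)

/-- The error bounds for one enumeration of the roots. -/
lemma exists_errorBound (hs : 1 ≤ s) (hd : 1 ≤ d) (h : IsRootEnumeration d ξ) :
    ∃ C₀ : ℝ, ∀ C : ℝ, C₀ ≤ C →
      (∀ a : ℝ, 1 < a → (frolovNodes ξ a).Finite ∧
        worstCaseError (frolovRule ξ a) (mixClassZero s d)
          ≤ ENNReal.ofReal (C * rate s d (frolovNodes ξ a).ncard)) ∧
      ∃ Q : (n : ℕ) → CubatureRule d n,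
        (∀ n : ℕ, 2 ≤ n →
          worstCaseError (Q n).eval (mixClassZero s d) ≤ ENNReal.ofReal (C * rate s d n)) ∧
        ∀ᶠ n : ℕ in atTop, ∃ a : ℝ, 1 < a ∧ (frolovNodes ξ a).Finite ∧
          (frolovNodes ξ a).ncard ≤ n ∧
          ∀ f : (Fin d → ℝ) → ℝ, (Q n).eval f = frolovRule ξ a f := by
  obtain ⟨C₁, hC₁, herr⟩ := frolovRule_error (s := s) hs hd h
  set D := nodeBound ξ with hD
  have hD1 : 1 ≤ D := nodeBound_ge ξ
  have hd0 : (d : ℝ) ≠ 0 := by positivity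
  set κ : ℝ := D ^ (d * s) * 3 ^ (((d : ℝ) - 1) / 2) with hκ
  have hκ0 : 0 ≤ κ := by positivity
  set b : ℝ := √(besselConst ξ) with hb
  have hb0 : 0 ≤ b := Real.sqrt_nonneg _
  refine ⟨max C₁ b * κ, fun C hC => ?_⟩
  have hC1 : C₁ * κ ≤ C := (mul_le_mul_of_nonneg_right (le_max_left _ _) hκ0).trans hC
  have hC2 : b * κ ≤ C := (mul_le_mul_of_nonneg_right (le_max_right _ _) hκ0).trans hC
  have hrule : ∀ (a : ℝ) (n : ℕ), 1 ≤ a → 2 ≤ n → a ≤ n → (n : ℝ) ≤ (D * a) ^ d →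
      ∀ f ∈ mixClassZero s d, |(∫ x in cube d, f x) - frolovRule ξ a f| ≤ C * rate s d n := by
    intro a n ha hn han hna f hf
    refine (herr a ha f hf).trans ?_
    refine (mul_le_mul_of_nonneg_left (scaled_bound_le_rate hd ha hD1 hn han hna) hC₁.le).trans ?_
    rw [← mul_assoc]
    exact mul_le_mul_of_nonneg_right hC1 (rate_nonneg s d hn)
  refine ⟨fun a ha => ?_, ?_⟩
  · obtain ⟨hfin, hcard⟩ := frolovNodes_finite_and_card h ha.le
    have hceil := ceil_le_ncard_frolovNodes hd h ha.le
    have h2 : 2 ≤ ⌈a⌉₊ := Nat.lt_ceil.2 (by exact_mod_cast ha)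
    exact ⟨hfin, worstCaseError_le (hrule a _ ha.le (h2.trans hceil)
      ((Nat.le_ceil a).trans (by exact_mod_cast hceil)) hcard)⟩
  · set A : ℕ → ℝ := fun n => (n : ℝ) ^ (d : ℝ)⁻¹ / D with hA
    have hAn : ∀ n, (D * A n) ^ d = n := fun n => by
      rw [hA, mul_div_cancel₀ _ (by positivity), ← Real.rpow_natCast, ← Real.rpow_mul (by positivity),
        inv_mul_cancel₀ hd0, Real.rpow_one]
    have hAle : ∀ n : ℕ, 1 ≤ n → A n ≤ n := fun n hn => by
      have h1 : (1 : ℝ) ≤ n := by exact_mod_cast hn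
      refine (div_le_self (by positivity) hD1).trans ?_
      refine (Real.rpow_le_rpow_of_exponent_le h1 (inv_le_one_of_one_le₀ ?_)).trans
        (Real.rpow_one _).le
      exact_mod_cast hd
    have hQ : ∀ n : ℕ, ∃ Q : CubatureRule d n,
        (1 < A n → ∀ f, Q.eval f = frolovRule ξ (A n) f) ∧ (A n ≤ 1 → ∀ f, Q.eval f = 0) := by
      intro n
      rcases lt_or_ge 1 (A n) with hn | hn
      · obtain ⟨hfin, hcard⟩ := frolovNodes_finite_and_card h hn.le
        rw [← hD, hAn] at hcard
        obtain ⟨Q, hQ⟩ := exists_cubatureRule (n := n) hfin.toFinset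
          (fun x hx => halfOpenCube_subset_cube ((hfin.mem_toFinset.1 hx).2))
          (by rw [← Set.ncard_eq_toFinset_card _ hfin]; exact_mod_cast hcard)
          (((A n) ^ d)⁻¹ * |(generator ξ).det|)
        refine ⟨Q, fun _ f => ?_, fun h' => absurd hn (not_lt.2 h')⟩
        rw [hQ, frolovRule, finsum_mem_eq_finite_toFinset_sum _ hfin]
      · obtain ⟨Q, hQ⟩ := exists_cubatureRule (d := d) (n := n) ∅ (by simp) (by simp) 0
        exact ⟨Q, fun h' => absurd h' (not_lt.2 hn), fun _ f => by rw [hQ, zero_mul]⟩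
    choose Q hQ1 hQ2 using hQ
    refine ⟨Q, fun n hn => worstCaseError_le fun f hf => ?_, ?_⟩
    · rcases lt_or_ge 1 (A n) with hn' | hn'
      · rw [hQ1 n hn']
        exact hrule _ n hn'.le hn (hAle n (by omega)) (hAn n).ge f hf
      · rw [hQ2 n hn', sub_zero]
        have h1 := scaled_bound_le_rate (s := s) hd le_rfl hD1 hn
          (by exact_mod_cast (by omega : 1 ≤ n)) (by
            rw [← hAn n]
            have : 0 ≤ A n := by positivity
            gcongr)
        rw [one_pow, inv_one, Real.log_one, add_zero, Real.one_rpow, one_mul, ← hκ] at h1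
        calc |∫ x in cube d, f x| ≤ b * 1 := by
              rw [mul_one]
              exact abs_integral_le h hf
          _ ≤ b * (κ * rate s d n) := mul_le_mul_of_nonneg_left h1 hb0
          _ = b * κ * rate s d n := (mul_assoc _ _ _).symm
          _ ≤ C * rate s d n := mul_le_mul_of_nonneg_right hC2 (rate_nonneg s d hn)
    · have hlim : Tendsto A atTop atTop :=
        ((tendsto_rpow_atTop (inv_pos.2 (by positivity))).comp
          tendsto_natCast_atTop_atTop).atTop_div_const (by positivity)
      filter_upwards [hlim.eventually_gt_atTop 1] with n hn
      obtain ⟨hfin, hcard⟩ := frolovNodes_finite_and_card h hn.le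
      rw [← hD, hAn] at hcard
      exact ⟨A n, hn, hfin, by exact_mod_cast hcard, hQ1 n hn⟩

end Nodes

end Frolov

end

theorem theorem1 (s d : ℕ) (hs : 1 ≤ s) (hd : 1 ≤ d) :
    (∃ ξ : Fin d → ℝ, Frolov.IsRootEnumeration d ξ) ∧
    ∃ C : ℝ, 0 < C ∧ ∀ ξ : Fin d → ℝ, Frolov.IsRootEnumeration d ξ →
      (∀ a : ℝ, 1 < a → (Frolov.frolovNodes ξ a).Finite ∧
        Frolov.worstCaseError (Frolov.frolovRule ξ a) (Frolov.mixClassZero s d)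
          ≤ ENNReal.ofReal (C * Frolov.rate s d (Frolov.frolovNodes ξ a).ncard)) ∧
      ∃ Q : (n : ℕ) → Frolov.CubatureRule d n,
        (∀ n : ℕ, 2 ≤ n →
          Frolov.worstCaseError (Q n).eval (Frolov.mixClassZero s d)
            ≤ ENNReal.ofReal (C * Frolov.rate s d n)) ∧
        ∀ᶠ n : ℕ in atTop, ∃ a : ℝ, 1 < a ∧ (Frolov.frolovNodes ξ a).Finite ∧
          (Frolov.frolovNodes ξ a).ncard ≤ n ∧
          ∀ f : (Fin d → ℝ) → ℝ, (Q n).eval f = Frolov.frolovRule ξ a f := by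
  refine ⟨Frolov.exists_isRootEnumeration d, ?_⟩
  choose! c hc using fun (ξ : Fin d → ℝ) (h : Frolov.IsRootEnumeration d ξ) =>
    Frolov.exists_errorBound hs hd h
  obtain ⟨C, hC⟩ := ((Frolov.finite_setOf_isRootEnumeration hd).image c).bddAbove
  exact ⟨max C 1, by positivity, fun ξ h =>
    hc ξ h _ ((hC (Set.mem_image_of_mem c h)).trans (le_max_left _ _))⟩
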